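/- **Model.** Let $G$ be a directed network on the nodes $V=\{0,\dots,n-1\}$, $n\ge 2$, with arbitrary real edge weights $w\ge 0$; $\mathrm{dist}(s,v)\in[0,\infty]$ is the distance from $s$ to $v$. The model is synchronous broadcast CONGEST with communication along edge directions only: in every round each node sends at most one message, the same to all its out-neighbours; a message consists of $O(1)$ node IDs, at most one distance, and an integer of $O(\log n)$ bits. Logarithms are to base 2; where an integer is needed, $\log n$ is rounded up. With $k=\log n$, for $0\le i\le k$ the set $S_i\subseteq V$ contains each node independently with probability $2^{-i}$ (so $S_0=V$), and $S_{k+1}=\emptyset$. **Phase $i$** ($0\le i\le k$), for a constant $c\ge 1$. Input: all nodes know $i$ and $S_i$; each node knows its incoming weights and whether it is in $S_{i+1}$; each node $v$ knows $d_{i+1}^v(s,v)=\mathrm{dist}(s,v)$ for all $s\in\bigcup_{j\ge i+1}S_j$. 1. Bellman–Ford of depth $h=c\,2^{i+1}\log n$ is run from every $s\in S_i$, one source after the other. It gives $\hat d_i^v(s,v)$, the least weight of an $s$–$v$ walk with at most $h$ edges. 2. For all $s\in S_i$ in parallel, FilteredBroadcast from $s$ through $B=S_{i+1}$ is run: $B_0=B$;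 $B_j$ arises from $B_{j-1}$ by keeping each node independently with probability $1/2$; each $v$ has a variable $\mathrm{output}^v=\infty$. For $j=\log n,\dots,0$ there is an iteration of $n$ rounds. In round 1 every $b\in B_j$ sets $\mathrm{output}^b=\hat d_i^b(s,b)$ and sends $M(s,b)=(s,b,\hat d_i^b(s,b))$. (Before any message of this broadcast has been received, a node whose estimate is $\infty$ need not take part.) In rounds $2,\dots,n$ every $v$ picks, among all $b$ whose message $M(s,b)$ it has received so far, one minimising $\hat d_i^b(s,b)+d_{i+1}^v(b,v)$ (ties broken by an arbitrary fixed rule); if this value is less than $\mathrm{output}^v$, then $v$ sends $M(s,b)$ and sets $\mathrm{output}^v$ to the value. The parallel runs are scheduled by random delays: time is divided into frames of $\kappa\log n$ rounds, source $s$ draws a uniform delay $\delta_s\in\{0,\dots,|S_i|\log^2 n\}$ (which is attached to all messages concerning $s$), and the broadcast from $s$ carries out its $\rho$-th round ($\rho=0,1,\dots$) in frame $\delta_s+\rho$. In a frame a node sends its messages one per round; those that do not fit are lost. This step lasts $|S_i|\log^2 n+(\log n+1)n$ frames. 3. Every $v$ internally sets $d_i^v(s,v)=\min\bigl(d_{i+1}^v(s,v),\hat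 d_i^v(s,v),\mathrm{output}^v\bigr)$ for $s\in\bigcup_{j\ge i}S_j$ (missing values count as $\infty$). All random choices are independent. Phase $i$ *terminates within $T$ rounds* if after $T$ rounds no message is ever sent, and from then on every node $v$ holds, for all $s\in\bigcup_{j\ge i}S_j$, the value $$\min\Bigl(d_{i+1}^v(s,v),\ \hat d_i^v(s,v),\ \min_{b\in S_{i+1}}\bigl(\hat d_i^b(s,b)+\mathrm{dist}(b,v)\bigr)\Bigr),$$ where $d_{i+1}^v(s,v)=\infty$ for $s\notin\bigcup_{j\ge i+1}S_j$, and the last two terms are present only for $s\in S_i$. **Lemma.** For all constants $c\ge1$ and $\gamma\in\mathbb N$ there are constants $\kappa\in\mathbb N$ and $C>0$ such that for all $n\ge2$, all such networks and all tie-breaking rules: (a) For every $0\le i\le\log n$, with probability at least $1-n^{-\gamma}$, phase $i$ terminates within $$C\,\bigl(n\log^2 n+|S_i|\log^3 n\bigr)$$ rounds, and moreover $n\log^2 n+|S_i|\log^3 n\le C\bigl(n\log^2 n+n\log^4 n/2^i\bigr)$. (b) With probability at least $1-n^{-\gamma}$, all phases $i=0,\dots,\log n$ (each with its input as above) terminate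 within numbers $T_i$ of rounds with $\sum_i T_i\le C\,n\log^4 n=\tilde O(n)$. -/

import Mathlib

open scoped ENNReal NNReal

namespace CongestAPSP

noncomputable section

/-! ### Weighted directed networks and distances -/

/-- A directed network on the nodes `0, …, n - 1` (their IDs) with arbitrary non-negative edge
weights.  Undirected networks are the symmetric ones. -/
structure Network (n : ℕ) where
  graph : Digraph (Fin n)
  weight : Fin n → Fin n → ℝ≥0

namespace Network

variable {n : ℕ} (N : Network n)

/-- `N.IsWalk s t ℓ x`: there is a directed walk from `s` to `t` with `ℓ` edges and weight `x`. -/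
inductive IsWalk (N : Network n) : Fin n → Fin n → ℕ → ℝ≥0 → Prop
  | nil (s : Fin n) : IsWalk N s s 0 0
  | snoc {s u v : Fin n} {l : ℕ} {x : ℝ≥0} :
      IsWalk N s u l x → N.graph.Adj u v → IsWalk N s v (l + 1) (x + N.weight u v)

/-- The distance from `s` to `t` (`∞` if `t` cannot be reached from `s`). -/
def dist (s t : Fin n) : ℝ≥0∞ :=
  ⨅ (l : ℕ) (x : ℝ≥0) (_ : N.IsWalk s t l x), (x : ℝ≥0∞)

/-- The least weight of a walk from `s` to `t` with at most `h` edges (`∞` if there is none). -/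
def hopDist (h : ℕ) (s t : Fin n) : ℝ≥0∞ :=
  ⨅ (l : ℕ) (x : ℝ≥0) (_ : N.IsWalk s t l x) (_ : l ≤ h), (x : ℝ≥0∞)

open Classical in
/-- The weight of the edge `(u, v)`, and `∞` if there is no such edge. -/
def len (u v : Fin n) : ℝ≥0∞ := if N.graph.Adj u v then (N.weight u v : ℝ≥0∞) else ⊤

end Network

/-! ### The synchronous broadcast CONGEST model with communication along edge directions -/

/-- A node program.  It accesses nothing but the node's own input, the number of the current
round, and the messages received.  In every round a node first computes (`wake`), then sends at
most one message, the same one to all out-neighbours (`send`), and at the end of the round takes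
in the messages of its in-neighbours (`receive`, where the messages are indexed by the IDs of
their senders). -/
structure Protocol (n : ℕ) (Input Msg Output : Type) where
  State : Type
  init : Input → State
  wake : ℕ → State → State
  send : ℕ → State → Option Msg
  receive : ℕ → State → (Fin n → Option Msg) → State
  output : State → Output

namespace Protocol

variable {n : ℕ} {Input Msg Output : Type}

open Classical in
/-- The states of all nodes after `t` rounds. -/
def config (P : Protocol n Input Msg Output) (N : Network n) (input : Fin n → Input) :
    ℕ → Fin n → P.State
  | 0 => fun v => P.init (input v)
  | t + 1 => fun v =>
      P.receive t (P.wake t (P.config N input t v)) fun u =>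
        if N.graph.Adj u v then P.send t (P.wake t (P.config N input t u)) else none

/-- The run has terminated after `T` rounds with outputs satisfying `good`: from then on no node
ever sends a message and every node `v` holds an output `o` with `good v o`. -/
def TerminatesWith (P : Protocol n Input Msg Output) (N : Network n) (input : Fin n → Input)
    (good : Fin n → Output → Prop) (T : ℕ) : Prop :=
  ∀ t, T ≤ t → ∀ v, P.send t (P.wake t (P.config N input t v)) = none ∧
    good v (P.output (P.config N input t v))

end Protocol

/-! ### Randomness -/

/-- The number `log n`, rounded up. -/
def lg (n : ℕ) : ℕ := Nat.clog 2 n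

/-- All random choices, for all phases:
* for every node `v` and every level `i`, the fair coins that decide whether `v ∈ S_i`;
* for every phase `i`, source `s` and node `b`, the fair coins with which `b` selects itself into
  the sets `B_1, B_2, …` of the filtered broadcast from `s`;
* for every phase `i` and source `s`, a start delay for the filtered broadcast from `s`, uniform
  in `{0, …, m * (lg n)^2}`; here `m` stands for `|S_i|`, and one delay is drawn for each value
  that `|S_i|` may take (only one of them is used). -/
abbrev Coins (n : ℕ) : Type :=
  (Fin n → Fin (lg n + 1) → Fin (lg n) → Bool) ×
  (Fin (lg n + 1) → Fin n → Fin n → Fin (lg n) → Bool) ×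
  (Fin (lg n + 1) → Fin n → (m : Fin (n + 1)) → Fin (m.1 * lg n ^ 2 + 1))

/-- All choices are independent and uniform. -/
def coinMeasure (n : ℕ) : MeasureTheory.Measure (Coins n) :=
  (PMF.uniformOfFintype (Coins n)).toMeasure

/-- The random set `S_i`: every node is selected with probability `1 / 2 ^ i` (all of its `i`
coins show `true`), for `0 ≤ i ≤ lg n`.  In particular `S_0 = V`.  Moreover `S_i = ∅` for
`i = lg n + 1`. -/
def sampled {n : ℕ} (ω : Coins n) (i : ℕ) : Finset (Fin n) :=
  {v | ∃ hi : i < lg n + 1, ∀ l : Fin (lg n), l.1 < i → ω.1 v ⟨i, hi⟩ l = true}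

open Classical in
/-- The union of all `S_j` with `j ≥ i`. -/
def sampledFrom {n : ℕ} (ω : Coins n) (i : ℕ) : Finset (Fin n) :=
  {v | ∃ j, i ≤ j ∧ v ∈ sampled ω j}

/-- The set `B_j` of the filtered broadcast from `s` through `S_{i+1}`: `B_0 = S_{i+1}`, and every
node of `B_{j-1}` is selected into `B_j` with probability `1 / 2`. -/
def between {n : ℕ} (ω : Coins n) (i : Fin (lg n + 1)) (s : Fin n) (j : ℕ) : Finset (Fin n) :=
  {b ∈ sampled ω (i.1 + 1) | ∀ l : Fin (lg n), l.1 < j → ω.2.1 i s b l = true}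

/-- The start delay that `s` has drawn for its filtered broadcast in phase `i`. -/
def startDelay {n : ℕ} (ω : Coins n) (i : Fin (lg n + 1)) (s : Fin n) : ℕ :=
  (ω.2.2 i s ⟨(sampled ω i).card,
    Nat.lt_succ_of_le ((Finset.card_le_univ _).trans_eq (Fintype.card_fin n))⟩ : ℕ)

/-! ### The node program of a phase -/

/-- What a node knows at the beginning of phase `i`. -/
structure PhaseInput (n : ℕ) where
  /-- the node's own ID `v` -/
  id : Fin n
  /-- the weights `w(u, v)` of the incoming edges, `∞` for a non-edge -/
  inLen : Fin n → ℝ≥0∞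
  /-- the set `S_i` of the sources of this phase -/
  src : Finset (Fin n)
  /-- the estimates `d_{i+1}^v(s, v)` from the previous phases, `∞` if there is none -/
  known : Fin n → ℝ≥0∞
  /-- whether the node itself belongs to `B_j` in the filtered broadcast from `s` -/
  inBetween : Fin n → ℕ → Bool
  /-- the node's own start delay (used if the node is a source) -/
  delay : ℕ

/-- Messages: a constant number of node IDs, one distance, and the start delay of the source
(an integer, at most `n * (lg n)^2`). -/
inductive PhaseMsg (n : ℕ) where
  /-- Bellman–Ford from `s`: the sender's current estimate is `d` -/
  | bf (s : Fin n) (d : ℝ≥0∞) (delay : ℕ) : PhaseMsg n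
  /-- filtered broadcast from `s`: the message `M(s, b) = (s, b, x)` -/
  | fb (s b : Fin n) (x : ℝ≥0∞) (delay : ℕ) : PhaseMsg n

/-- The state of a node `v` during a phase. -/
structure PhaseState (n : ℕ) where
  inp : PhaseInput n
  /-- the Bellman–Ford estimate of the distance from `s` -/
  dhat : Fin n → ℝ≥0∞
  /-- whether a Bellman–Ford estimate has decreased in the round before -/
  fresh : Bool
  /-- the start delay of `s`, if the node has learnt it -/
  startOf : Fin n → Option ℕ
  /-- the value `x` of the messages `M(s, b) = (s, b, x)` received so far,
  `∞` if no such message was received -/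
  est : Fin n → Fin n → ℝ≥0∞
  /-- the variable `output^v` of the filtered broadcast from `s` -/
  out : Fin n → ℝ≥0∞
  /-- the messages to be sent in the current frame -/
  queue : List (PhaseMsg n)

/-- The depth `c 2^{i+1} log n` of Bellman–Ford in phase `i`. -/
def depth (n c i : ℕ) : ℕ := c * 2 ^ (i + 1) * lg n

/-- The number of rounds of the first step, if there are `m` sources: Bellman–Ford is run from
one source after the other. -/
def bfRounds (n c i m : ℕ) : ℕ := m * depth n c i

/-- The number of (real) rounds of a frame.  In a frame, every filtered broadcast that is under way
carries out one of its own rounds. -/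
def frameLen (n κ : ℕ) : ℕ := κ * lg n

/-- A filtered broadcast takes `(lg n + 1) * n` rounds of its own. -/
def fbRounds (n : ℕ) : ℕ := (lg n + 1) * n

/-- The number of frames of the second step, if there are `m` sources: start delays are at most
`m * (lg n)^2`. -/
def numFrames (n m : ℕ) : ℕ := m * lg n ^ 2 + fbRounds n

/-- The round in which a phase with `m` sources ends. -/
def phaseEnd (n c κ i m : ℕ) : ℕ := bfRounds n c i m + numFrames n m * frameLen n κ

section Program

variable {n : ℕ}

def initState (x : PhaseInput n) : PhaseState n where
  inp := x
  dhat s := if s = x.id ∧ s ∈ x.src then 0 else ⊤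
  fresh := false
  startOf s := if s = x.id ∧ s ∈ x.src then some x.delay else none
  est _ _ := ⊤
  out _ := ⊤
  queue := []

/-- The value `d̂^b(s, b) + d^v(b, v)` of a between-node `b`, as far as `v` knows it. -/
def value (st : PhaseState n) (s b : Fin n) : ℝ≥0∞ := st.est s b + st.inp.known b

open Classical in
/-- The between-nodes of least value, of which `v` picks one. -/
def best (st : PhaseState n) (s : Fin n) : Finset (Fin n) :=
  {b | ∀ b', value st s b ≤ value st s b'}

open Classical in
/-- One round of the filtered broadcast from `s` at a node, carried out in frame `β`: the new value
of the variable `output^v`, and the message that is to be sent.  If the broadcast has been delayed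
by `δ` then this is its round number `ρ = β - δ` (counted from `0`), that is, Round
`ρ % n + 1` of Iteration `lg n - ρ / n`. -/
def fbStep (tie : Fin n → Fin n → Finset (Fin n) → Fin n) (β : ℕ) (st : PhaseState n)
    (s : Fin n) : ℝ≥0∞ × Option (PhaseMsg n) :=
  match st.startOf s with
  | none => (st.out s, none)
  | some δ =>
    if δ ≤ β ∧ β < δ + fbRounds n then
      if (β - δ) % n = 0 then
        -- Round 1: the nodes of `B_j` start
        if st.inp.inBetween s (lg n - (β - δ) / n) = true then
          (st.dhat s, some (.fb s st.inp.id (st.dhat s) δ))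
        else (st.out s, none)
      else
        -- Rounds 2 to n: the filter
        if value st s (tie st.inp.id s (best st s)) < st.out s then
          (value st s (tie st.inp.id s (best st s)),
            some (.fb s (tie st.inp.id s (best st s))
              (st.est s (tie st.inp.id s (best st s))) δ))
        else (st.out s, none)
    else (st.out s, none)

/-- At the beginning of frame `β`, one round of every filtered broadcast is carried out. -/
def frameStep (tie : Fin n → Fin n → Finset (Fin n) → Fin n) (β : ℕ) (st : PhaseState n) :
    PhaseState n :=
  { st with
    out := fun s => (fbStep tie β st s).1
    queue := (List.finRange n).filterMap fun s => (fbStep tie β st s).2 }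

open Classical in
/-- The source from which Bellman–Ford is run in round `t` of the first step: the sources take
turns, in the order of their IDs. -/
def bfSource (c i : ℕ) (src : Finset (Fin n)) (t : ℕ) : Option (Fin n) :=
  ((List.finRange n).filter (· ∈ src))[t / depth n c i]?

open Classical in
/-- Take in one message, received from `u`. -/
def absorb (st : PhaseState n) (u : Fin n) : PhaseMsg n → PhaseState n
  | .bf s d δ =>
      if d + st.inp.inLen u < st.dhat s then
        { st with
          dhat := Function.update st.dhat s (d + st.inp.inLen u)
          startOf := Function.update st.startOf s (some δ)
          fresh := true }
      else st
  | .fb s b x δ =>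
      { st with
        est := Function.update st.est s (Function.update (st.est s) b x)
        startOf := Function.update st.startOf s (some δ) }

/-- The node program of phase `i`.

First step (rounds `t < bfRounds`): Bellman–Ford up to depth `c 2^{i+1} log n` from every source,
one source after the other.  In its first round every node sends its estimate, later on a node
sends its estimate whenever it has just decreased.

Second step: the filtered broadcasts from all sources in parallel, scheduled by random start
delays.  Time is divided into frames of `κ * lg n` rounds; in a frame, every broadcast that is
under way carries out one round, and its messages are sent one per (real) round.  If a
node has more messages for a frame than fit into it, the excess messages are lost.

At the end the node internally computes the minimum of `d_{i+1}^v`, of the Bellman–Ford estimate,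
and of the output of the filtered broadcast. -/
def phaseProtocol (c κ i : ℕ) (tie : Fin n → Fin n → Finset (Fin n) → Fin n) :
    Protocol n (PhaseInput n) (PhaseMsg n) (Fin n → ℝ≥0∞) where
  State := PhaseState n
  init := initState
  wake t st :=
    if bfRounds n c i st.inp.src.card ≤ t ∧ t < phaseEnd n c κ i st.inp.src.card ∧
        (t - bfRounds n c i st.inp.src.card) % frameLen n κ = 0 then
      frameStep tie ((t - bfRounds n c i st.inp.src.card) / frameLen n κ) st
    else st
  send t st :=
    if t < bfRounds n c i st.inp.src.card then
      match bfSource c i st.inp.src t with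
      | none => none
      | some s =>
        if t % depth n c i = 0 ∨ st.fresh = true then
          some (.bf s (st.dhat s) ((st.startOf s).getD 0))
        else none
    else if t < phaseEnd n c κ i st.inp.src.card then
      st.queue[(t - bfRounds n c i st.inp.src.card) % frameLen n κ]?
    else none
  receive _ st msgs :=
    (List.finRange n).foldl
      (fun st' u => match msgs u with
        | none => st'
        | some m => absorb st' u m)
      { st with fresh := false }
  output st := fun s => min (st.inp.known s) (min (st.dhat s) (st.out s))

end Program

/-! ### Phase `i` of the main algorithm -/

variable {n : ℕ}

open Classical in
/-- The input of node `v` in phase `i`: for every `s` in the union of the `S_j`, `j ≥ i + 1`, the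
node knows `d_{i+1}^v(s, v) = dist(s, v)`. -/
def phaseInput (N : Network n) (i : Fin (lg n + 1)) (ω : Coins n) (v : Fin n) : PhaseInput n where
  id := v
  inLen u := N.len u v
  src := sampled ω i
  known s := if s ∈ sampledFrom ω (i + 1) then N.dist s v else ⊤
  inBetween s j := decide (v ∈ between ω i s j)
  delay := startDelay ω i v

open Classical in
/-- The value `d_i^v(s, v) = min(d_{i+1}^v(s, v), d̂_i^v(s, v), d̄_i^v(s, v))` that node `v` has to
hold at the end of phase `i`, where `d̂_i` is the Bellman–Ford estimate of depth `c 2^{i+1} log n`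
and `d̄_i^v(s, v)` is the minimum of `d̂_i^b(s, b) + dist(b, v)` over `b ∈ S_{i+1}`; the last two
exist for `s ∈ S_i` only. -/
def phaseResult (N : Network n) (c : ℕ) (i : Fin (lg n + 1)) (ω : Coins n) (s v : Fin n) : ℝ≥0∞ :=
  min (if s ∈ sampledFrom ω (i + 1) then N.dist s v else ⊤)
    (if s ∈ sampled ω i then
      min (N.hopDist (depth n c i) s v)
        (⨅ b ∈ sampled ω (i + 1), (N.hopDist (depth n c i) s b + N.dist b v))
    else ⊤)

/-- Phase `i` terminates within `T` rounds: from then on no message is sent, and every node `v`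
holds `d_i^v(s, v)` for every `s` in the union of the `S_j`, `j ≥ i`. -/
def PhaseTerminates (N : Network n) (c κ : ℕ) (tie : Fin n → Fin n → Finset (Fin n) → Fin n)
    (i : Fin (lg n + 1)) (ω : Coins n) (T : ℕ) : Prop :=
  (phaseProtocol c κ i tie).TerminatesWith N (phaseInput N i ω)
    (fun v d => ∀ s ∈ sampledFrom ω i, d s = phaseResult N c i ω s v) T

end

end CongestAPSP

/-!
Phase `i` always takes `phaseEnd` rounds, which is within the claimed bounds if `|S_i|` is
`O(n log n / 2 ^ i)`, and its result is correct if no message is lost.  Both conditions hold with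
high probability.

*Correctness without loss.*  A filtered broadcast from one source is analysed on its own, as a
process `Broadcast.run` in which every message arrives.  Every node whose variable `out` has a
finite value has sent a message that justifies this value (`exists_heard_of_out_ne_top`), so that in
each iteration correct values spread along shortest paths, one edge per round; since cycles may be
cut out, `n - 1` rounds after the first one suffice (`out_eq_target`).  `inFrame_phaseConfig` shows
that the node program carries out all these processes in parallel, shifted by the start delays, as
long as no node has more messages for a frame than fit into it.  By induction over the frames it is
enough to bound the number `load` of messages that a node *would* send in a frame if nothing
were lost, and this number depends on the delays only through the shifts.

*Few messages per broadcast.*  At the beginning of the iteration for `B_j`, the nodes know the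
minimum over `B_{j+1}`.  After two rounds every further message of a node uses up one `b ∈ B_j`
that is better than all of `B_{j+1}` (`card_sendRounds_add_card_below_le`).  Having `z` such nodes
requires that the `z` best nodes of `B_j` all fail to enter `B_{j+1}`, which has probability
`2 ^ (-z)` (`prob_better_le`).  Hence, with high probability, each node sends `O(log² n)` messages
in each broadcast.

*Light frames.*  Given this, with `m = |S_i|` sources and uniform delays up to `m log² n`, each
source contributes to a given frame and node with probability `O(1 / m)`, independently, so that the
load has a bounded exponential moment and exceeds `κ log n` with polynomially small probability
(`prob_le_load_le`).  The same Chernoff bound `prob_le_card_le` controls `|S_i|` and `|B_{log n}|`.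

All probabilities are uniform probabilities on finite types.  Conditioning is replaced by
`prob_le_of_resample`: redrawing one component of the random choices preserves the distribution, so
it is enough to bound the probability of an event over that component with all others fixed.
-/

/-! ### Walks and distances -/

namespace CongestAPSP

namespace Network

variable {n : ℕ} {N : Network n} {s t u v : Fin n} {l k : ℕ} {x y : ℝ≥0}

theorem IsWalk.trans (h : N.IsWalk s u l x) (h' : N.IsWalk u t k y) :
    N.IsWalk s t (l + k) (x + y) := by
  induction h' with
  | nil => simpa using h
  | snoc _ hadj ih => simpa only [← add_assoc] using ih.snoc hadj

theorem dist_le_of_isWalk (h : N.IsWalk s t l x) : N.dist s t ≤ x :=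
  iInf_le_of_le l (iInf₂_le x h)

theorem hopDist_le_of_isWalk (h : N.IsWalk s t l x) (hl : l ≤ k) : N.hopDist k s t ≤ x :=
  iInf_le_of_le l (iInf_le_of_le x (iInf₂_le h hl))

theorem len_of_adj (h : N.graph.Adj u v) : N.len u v = N.weight u v := if_pos h

theorem len_of_not_adj (h : ¬ N.graph.Adj u v) : N.len u v = ⊤ := if_neg h

theorem dist_self (s : Fin n) : N.dist s s = 0 :=
  le_antisymm ((dist_le_of_isWalk (.nil s)).trans (by simp)) zero_le

theorem dist_le_dist_add_weight (s : Fin n) (h : N.graph.Adj u v) :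
    N.dist s v ≤ N.dist s u + N.weight u v := by
  rw [dist, dist, ENNReal.iInf_add]
  refine le_iInf fun l => ?_
  rw [ENNReal.iInf_add]
  refine le_iInf fun x => ?_
  rw [ENNReal.iInf_add]
  refine le_iInf fun hw => ?_
  rw [← ENNReal.coe_add]
  exact dist_le_of_isWalk (hw.snoc h)

theorem hopDist_zero (s v : Fin n) : N.hopDist 0 s v = if s = v then 0 else ⊤ := by
  split_ifs with h
  · subst h
    exact le_antisymm ((hopDist_le_of_isWalk (.nil s) le_rfl).trans (by simp)) zero_le
  · refine top_le_iff.1 (le_iInf fun l => le_iInf fun x => le_iInf fun hw => le_iInf fun hl => ?_)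
    cases hw with
    | nil => exact absurd rfl h
    | snoc => omega

theorem hopDist_antitone (s v : Fin n) : Antitone fun k => N.hopDist k s v := fun _ _ hk =>
  le_iInf fun _ => le_iInf fun _ => le_iInf fun hw => le_iInf fun hl =>
    hopDist_le_of_isWalk hw (hl.trans hk)

theorem hopDist_succ_le (k : ℕ) (s u v : Fin n) :
    N.hopDist (k + 1) s v ≤ N.hopDist k s u + N.len u v := by
  by_cases h : N.graph.Adj u v
  · rw [len_of_adj h, hopDist, hopDist, ENNReal.iInf_add]
    refine le_iInf fun l => ?_
    rw [ENNReal.iInf_add]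
    refine le_iInf fun x => ?_
    rw [ENNReal.iInf_add]
    refine le_iInf fun hw => ?_
    rw [ENNReal.iInf_add]
    refine le_iInf fun hl => ?_
    rw [← ENNReal.coe_add]
    exact hopDist_le_of_isWalk (hw.snoc h) (by omega)
  · simp [len_of_not_adj h]

/-- One round of Bellman–Ford: a lower bound for all one-edge extensions bounds the next stage. -/
theorem le_hopDist_succ {a : ℝ≥0∞} (h0 : a ≤ N.hopDist k s v)
    (h : ∀ u, a ≤ N.hopDist k s u + N.len u v) : a ≤ N.hopDist (k + 1) s v := by
  refine le_iInf fun l => le_iInf fun x => le_iInf fun hw => le_iInf fun hl => ?_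
  cases hw with
  | nil => exact h0.trans (hopDist_le_of_isWalk (.nil s) k.zero_le)
  | @snoc u _ l x hw hadj =>
    refine (h u).trans ?_
    rw [len_of_adj hadj, ENNReal.coe_add]
    gcongr
    exact hopDist_le_of_isWalk hw (by omega)

/-- The prefixes and suffixes of a walk. -/
theorem IsWalk.exists_split (h : N.IsWalk s t l x) :
    ∃ (p : ℕ → Fin n) (y : ℕ → ℝ≥0), (∀ j ≤ l, N.IsWalk s (p j) j (y j)) ∧
      (∀ j j', j ≤ j' → j' ≤ l → y j ≤ y j') ∧
      ∀ j ≤ l, ∃ z, N.IsWalk (p j) t (l - j) z ∧ y j + z = x := by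
  induction h with
  | nil =>
    refine ⟨fun _ => s, fun _ => 0, ?_, fun _ _ _ _ => le_rfl, ?_⟩
    · intro j hj
      obtain rfl : j = 0 := by omega
      exact .nil s
    · intro j hj
      obtain rfl : j = 0 := by omega
      exact ⟨0, .nil s, by simp⟩
  | @snoc u v l x hw hadj ih =>
    obtain ⟨p, y, h1, h2, h3⟩ := ih
    have hyx : ∀ j ≤ l, y j ≤ x := fun j hj => by
      obtain ⟨z, -, hz⟩ := h3 j hj
      exact hz ▸ le_self_add
    refine ⟨fun j => if j ≤ l then p j else v, fun j => if j ≤ l then y j else x + N.weight u v,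
      ?_, ?_, ?_⟩
    · intro j hj
      by_cases hjl : j ≤ l
      · simpa [hjl] using h1 j hjl
      · obtain rfl : j = l + 1 := by omega
        simpa using hw.snoc hadj
    · intro j j' hjj hj'
      by_cases hjl : j' ≤ l
      · simpa [hjl, hjj.trans hjl] using h2 j j' hjj hjl
      · by_cases hj : j ≤ l
        · simpa [hj, hjl] using (hyx j hj).trans le_self_add
        · simp [hj, hjl]
    · intro j hj
      by_cases hjl : j ≤ l
      · obtain ⟨z, hz, hzx⟩ := h3 j hjl
        refine ⟨z + N.weight u v, ?_, ?_⟩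
        · rw [Nat.sub_add_comm hjl]
          simpa [hjl] using hz.snoc hadj
        · simp [hjl, ← hzx, add_assoc]
      · obtain rfl : j = l + 1 := by omega
        exact ⟨0, by simpa using .nil v, by simp⟩

/-- Cutting out cycles does not increase the weight, so that walks with fewer than `n` edges
suffice. -/
theorem IsWalk.exists_short (h : N.IsWalk s t l x) :
    ∃ l' y, l' < n ∧ y ≤ x ∧ N.IsWalk s t l' y := by
  induction l using Nat.strong_induction_on generalizing x with
  | _ l ih =>
    by_cases hl : l < n
    · exact ⟨l, x, hl, le_rfl, h⟩
    obtain ⟨p, y, h1, h2, h3⟩ := h.exists_split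
    obtain ⟨a, b, hab, hp⟩ : ∃ a b : Fin (l + 1), a < b ∧ p a = p b := by
      obtain ⟨a, b, hne, hp⟩ := Fintype.exists_ne_map_eq_of_card_lt
        (fun j : Fin (l + 1) => p j) (by simp; omega)
      rcases lt_or_gt_of_ne hne with hlt | hlt
      · exact ⟨a, b, hlt, hp⟩
      · exact ⟨b, a, hlt, hp.symm⟩
    have hb : (b : ℕ) ≤ l := by omega
    have hab' : (a : ℕ) < b := hab
    obtain ⟨z, hz, hzx⟩ := h3 b hb
    have hw := (h1 a (by omega)).trans (hp ▸ hz)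
    obtain ⟨l', y', hl', hy', hw'⟩ := ih _ (by omega) hw
    refine ⟨l', y', hl', hy'.trans ?_, hw'⟩
    rw [← hzx]
    gcongr
    exact h2 a b hab'.le hb

/-- A bound for all walks with fewer than `n` edges is a bound for the distance. -/
theorem le_add_dist {a e : ℝ≥0∞} (h : ∀ l x, l < n → N.IsWalk s t l x → a ≤ e + x) :
    a ≤ e + N.dist s t := by
  rw [dist, ENNReal.add_iInf]
  refine le_iInf fun l => ?_
  rw [ENNReal.add_iInf]
  refine le_iInf fun x => ?_
  rw [ENNReal.add_iInf]
  refine le_iInf fun hw => ?_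
  obtain ⟨l', y, hl', hy, hw'⟩ := hw.exists_short
  refine (h l' y hl' hw').trans ?_
  gcongr

end Network

end CongestAPSP

/-! ### A single filtered broadcast without message loss -/

namespace CongestAPSP

/-- The data of one filtered broadcast from a fixed source: the network, the estimate `est b` that
a between-node `b` announces, the estimates `known b v` of the distance from `b` that are stored at
`v`, the set `layer k` of the nodes that start in iteration `k` (counted from `0`, so that it is
the set `B_j` for `j = log n - k`), and the rule for breaking ties. -/
structure Broadcast (n : ℕ) where
  net : Network n
  est : Fin n → ℝ≥0∞
  known : Fin n → Fin n → ℝ≥0∞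
  layer : ℕ → Finset (Fin n)
  tie : Fin n → Finset (Fin n) → Fin n
  tie_mem : ∀ v A, A.Nonempty → tie v A ∈ A
  layer_mono : Monotone layer
  known_eq : ∀ k, ∀ b ∈ layer k, ∀ v, known b v = net.dist b v

namespace Broadcast

/-- The state of a broadcast between two rounds: the variable `out` of every node, and the set of
those `b` whose message has reached the node. -/
structure State (n : ℕ) where
  out : Fin n → ℝ≥0∞
  heard : Fin n → Set (Fin n)

variable {n : ℕ} (F : Broadcast n)

/-- The length of the best path to `v` through `b` that the broadcast can find. -/
noncomputable def val (b v : Fin n) : ℝ≥0∞ := F.est b + F.known b v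

/-- The least value of a node of `layer k`. -/
noncomputable def target (k : ℕ) (v : Fin n) : ℝ≥0∞ := ⨅ b ∈ F.layer k, F.val b v

/-- A node takes part once it has a finite estimate of its own or has received a message. -/
def Active (σ : State n) (v : Fin n) : Prop := F.est v ≠ ⊤ ∨ (σ.heard v).Nonempty

open Classical in
/-- The value of `b`, as far as `v` knows it. -/
noncomputable def score (σ : State n) (v b : Fin n) : ℝ≥0∞ :=
  (if b ∈ σ.heard v then F.est b else ⊤) + F.known b v

open Classical in
/-- The set of all minimisers of `f`. -/
noncomputable def minimizers (f : Fin n → ℝ≥0∞) : Finset (Fin n) := {b | ∀ b', f b ≤ f b'}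

/-- The between-node that `v` picks. -/
noncomputable def pick (σ : State n) (v : Fin n) : Fin n :=
  F.tie v (minimizers (F.score σ v))

open Classical in
/-- The node whose message `v` forwards in round `ρ` (counted from `0`), if any. -/
noncomputable def sent (ρ : ℕ) (σ : State n) (v : Fin n) : Option (Fin n) :=
  if F.Active σ v then
    if ρ % n = 0 then
      if v ∈ F.layer (ρ / n) then some v else none
    else
      if F.score σ v (F.pick σ v) < σ.out v then some (F.pick σ v) else none
  else none

/-- Round `ρ` of the broadcast. -/
noncomputable def step (ρ : ℕ) (σ : State n) : State n where
  out v := (F.sent ρ σ v).elim (σ.out v) fun b => F.val b v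
  heard v := σ.heard v ∪ {b | ∃ u, F.net.graph.Adj u v ∧ F.sent ρ σ u = some b}

/-- The state before round `ρ`. -/
noncomputable def run : ℕ → State n
  | 0 => ⟨fun _ => ⊤, fun _ => ∅⟩
  | ρ + 1 => F.step ρ (run ρ)

variable {F} {σ : State n} {ρ k : ℕ} {b b' u v : Fin n}

theorem score_of_mem (h : b ∈ σ.heard v) : F.score σ v b = F.val b v := by
  simp [score, val, h]

theorem score_of_notMem (h : b ∉ σ.heard v) : F.score σ v b = ⊤ := by
  simp [score, h]

theorem mem_minimizers {f : Fin n → ℝ≥0∞} : b ∈ minimizers f ↔ ∀ b', f b ≤ f b' := by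
  simp [minimizers]

theorem score_pick_le (σ : State n) (v b : Fin n) : F.score σ v (F.pick σ v) ≤ F.score σ v b := by
  have : Nonempty (Fin n) := ⟨v⟩
  obtain ⟨b₀, h₀⟩ := Finite.exists_min (F.score σ v)
  exact mem_minimizers.1 (F.tie_mem v _ ⟨b₀, mem_minimizers.2 h₀⟩) b

theorem sent_start (hρ : ρ % n = 0) (h : F.sent ρ σ v = some b) : b = v ∧ v ∈ F.layer (ρ / n) := by
  grind [sent]

theorem sent_filter (hρ : ρ % n ≠ 0) (h : F.sent ρ σ v = some b) :
    b ∈ σ.heard v ∧ F.val b v < σ.out v := by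
  have h' : F.score σ v b < σ.out v ∧ b = F.pick σ v := by grind [sent]
  have hb : b ∈ σ.heard v := by
    by_contra hb
    rw [score_of_notMem hb] at h'
    exact not_top_lt h'.1
  exact ⟨hb, score_of_mem (F := F) hb ▸ h'.1⟩

theorem step_out_of_sent (h : F.sent ρ σ v = some b) : (F.step ρ σ).out v = F.val b v := by
  simp [step, h]

theorem step_out_of_not_sent (h : F.sent ρ σ v = none) : (F.step ρ σ).out v = σ.out v := by
  simp [step, h]

theorem heard_subset_step (ρ : ℕ) (σ : State n) (v : Fin n) :
    σ.heard v ⊆ (F.step ρ σ).heard v :=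
  Set.subset_union_left

theorem mem_heard_step_of_sent (hadj : F.net.graph.Adj u v) (h : F.sent ρ σ u = some b) :
    b ∈ (F.step ρ σ).heard v :=
  Or.inr ⟨u, hadj, h⟩

theorem step_out_le (hρ : ρ % n ≠ 0) (σ : State n) (v : Fin n) :
    (F.step ρ σ).out v ≤ σ.out v := by
  cases h : F.sent ρ σ v with
  | none => rw [step_out_of_not_sent h]
  | some b => rw [step_out_of_sent h]; exact (sent_filter hρ h).2.le

theorem step_out_le_val (hρ : ρ % n ≠ 0) (hb : b ∈ σ.heard v) :
    (F.step ρ σ).out v ≤ F.val b v := by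
  have hle := score_pick_le (F := F) σ v b
  rw [score_of_mem hb] at hle
  by_cases hlt : F.score σ v (F.pick σ v) < σ.out v
  · have hs : F.sent ρ σ v = some (F.pick σ v) := by
      have : F.Active σ v := Or.inr ⟨b, hb⟩
      simp [sent, this, hρ, hlt]
    rw [step_out_of_sent hs, ← score_of_mem (sent_filter hρ hs).1]
    exact hle
  · have hs : F.sent ρ σ v = none := by simp [sent, hρ, hlt]
    rw [step_out_of_not_sent hs]
    exact (not_lt.1 hlt).trans hle

theorem val_self (h : v ∈ F.layer k) : F.val v v = F.est v := by
  rw [val, F.known_eq k v h, Network.dist_self, add_zero]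

theorem step_out_le_est (hρ : ρ % n = 0) (hv : v ∈ F.layer (ρ / n)) :
    (F.step ρ σ).out v ≤ F.est v := by
  by_cases hx : F.est v = ⊤
  · simp [hx]
  · have hs : F.sent ρ σ v = some v := by
      have : F.Active σ v := Or.inl hx
      simp [sent, this, hρ, hv]
    rw [step_out_of_sent hs, val_self hv]

theorem val_le_val_add_weight (hb : b ∈ F.layer k) (hadj : F.net.graph.Adj u v) :
    F.val b v ≤ F.val b u + F.net.weight u v := by
  rw [val, val, F.known_eq k b hb, F.known_eq k b hb, add_assoc]
  gcongr
  exact Network.dist_le_dist_add_weight b hadj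

theorem heard_run_subset (hρ : ρ ≤ (k + 1) * n) : ∀ b ∈ (F.run ρ).heard v, b ∈ F.layer k := by
  induction ρ generalizing v with
  | zero => intro b hb; exact hb.elim
  | succ ρ ih =>
    rintro b (hb | ⟨u, -, hu⟩)
    · exact ih (by omega) b hb
    · by_cases h0 : ρ % n = 0
      · obtain ⟨rfl, hl⟩ := sent_start h0 hu
        refine F.layer_mono ?_ hl
        have : ρ / n < k + 1 := Nat.div_lt_of_lt_mul (by rw [mul_comm]; omega)
        omega
      · exact ih (by omega) b (sent_filter h0 hu).1

theorem sent_mem_layer (hρ : ρ < (k + 1) * n) (h : F.sent ρ (F.run ρ) v = some b) :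
    b ∈ F.layer k := by
  by_cases h0 : ρ % n = 0
  · obtain ⟨rfl, hl⟩ := sent_start h0 h
    refine F.layer_mono ?_ hl
    have : ρ / n < k + 1 := Nat.div_lt_of_lt_mul (by rw [mul_comm]; omega)
    omega
  · exact heard_run_subset hρ.le b (sent_filter h0 h).1

theorem target_le_out (hρ : ρ ≤ (k + 1) * n) (v : Fin n) : F.target k v ≤ (F.run ρ).out v := by
  induction ρ with
  | zero => exact le_top
  | succ ρ ih =>
    cases h : F.sent ρ (F.run ρ) v with
    | none => rw [run, step_out_of_not_sent h]; exact ih (by omega)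
    | some b => rw [run, step_out_of_sent h]; exact iInf₂_le b (sent_mem_layer hρ h)

/-- A finite value of `out` at `u` is backed by a message that `u` has sent. -/
theorem exists_heard_of_out_ne_top (ρ : ℕ) (hadj : F.net.graph.Adj u v)
    (h : (F.run ρ).out u ≠ ⊤) : ∃ b ∈ (F.run ρ).heard v, F.val b u ≤ (F.run ρ).out u := by
  induction ρ with
  | zero => exact absurd rfl h
  | succ ρ ih =>
    cases hs : F.sent ρ (F.run ρ) u with
    | none =>
      rw [run, step_out_of_not_sent hs] at h ⊢
      obtain ⟨b, hb, hle⟩ := ih h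
      exact ⟨b, heard_subset_step _ _ _ hb, hle⟩
    | some b =>
      rw [run, step_out_of_sent hs]
      exact ⟨b, mem_heard_step_of_sent hadj hs, le_rfl⟩

/-- The value of `out` at `v` is matched by the own estimate of `v` or by a received message. -/
theorem est_le_out_or_exists_heard (ρ : ℕ) (v : Fin n) :
    F.est v ≤ (F.run ρ).out v ∨ ∃ b ∈ (F.run ρ).heard v, F.val b v ≤ (F.run ρ).out v := by
  induction ρ with
  | zero => exact Or.inl le_top
  | succ ρ ih =>
    cases hs : F.sent ρ (F.run ρ) v with
    | none =>
      rw [run, step_out_of_not_sent hs]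
      exact ih.imp_right fun ⟨b, hb, hle⟩ => ⟨b, heard_subset_step _ _ _ hb, hle⟩
    | some b =>
      rw [run, step_out_of_sent hs]
      by_cases h0 : ρ % n = 0
      · obtain ⟨rfl, -⟩ := sent_start h0 hs
        exact Or.inl le_self_add
      · exact Or.inr ⟨b, heard_subset_step _ _ _ (sent_filter h0 hs).1, le_rfl⟩

/-- In iteration `k`, correct values spread along walks, one edge per round. -/
theorem out_le_of_isWalk {l : ℕ} {y : ℝ≥0} (hb : b ∈ F.layer k) (hl : l < n)
    (hw : F.net.IsWalk b v l y) : ∀ r, l ≤ r → r < n →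
      (F.run (k * n + r + 1)).out v ≤ F.est b + y := by
  have mod_ne : ∀ r, r < n → r ≠ 0 → (k * n + r) % n ≠ 0 := fun r hr h0 => by
    rw [Nat.mul_add_mod_of_lt hr]; exact h0
  induction l generalizing v y with
  | zero =>
    cases hw
    intro r _ hr
    induction r with
    | zero =>
      simpa [run] using step_out_le_est (F := F) (σ := F.run (k * n)) (ρ := k * n) (v := b)
        (by simp) (by rwa [Nat.mul_div_cancel _ (by omega)])
    | succ r ih =>
      exact (step_out_le (mod_ne (r + 1) hr (by omega)) _ _).trans (ih (Nat.zero_le _) (by omega))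
  | succ l ih =>
    cases hw with
    | @snoc u _ _ y hw hadj =>
      intro r hlr hr
      induction r, hlr using Nat.le_induction with
      | base =>
        have h1 := ih (by omega) hw l le_rfl (by omega)
        by_cases hx : F.est b = ⊤
        · simp [hx]
        have hne : (F.run (k * n + l + 1)).out u ≠ ⊤ :=
          ne_top_of_le_ne_top (ENNReal.add_ne_top.2 ⟨hx, ENNReal.coe_ne_top⟩) h1
        obtain ⟨b', hb', hle⟩ := exists_heard_of_out_ne_top _ hadj hne
        have hb'l : b' ∈ F.layer k := heard_run_subset (by rw [add_mul]; omega) b' hb'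
        refine (step_out_le_val (mod_ne (l + 1) hr (by omega)) hb').trans ?_
        refine (val_le_val_add_weight hb'l hadj).trans ?_
        rw [ENNReal.coe_add, ← add_assoc]
        gcongr
        exact hle.trans h1
      | succ r hlr ih2 =>
        exact (step_out_le (mod_ne (r + 1) hr (by omega)) _ _).trans (ih2 (by omega))

/-- Every iteration ends with the correct values for its layer. -/
theorem out_eq_target (hn : 0 < n) (k : ℕ) (v : Fin n) :
    (F.run ((k + 1) * n)).out v = F.target k v := by
  refine le_antisymm (le_iInf₂ fun b hb => ?_) (target_le_out le_rfl v)
  rw [val, F.known_eq k b hb]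
  refine Network.le_add_dist fun l x hl hw => ?_
  have h := out_le_of_isWalk hb hl hw (n - 1) (by omega) (by omega)
  rwa [add_assoc, Nat.sub_add_cancel hn, ← Nat.succ_mul] at h

/-- The values that iteration `k` can improve on: `out` at the end of the iteration before,
and `∞` if there is none. -/
noncomputable def priorTarget (F : Broadcast n) : ℕ → Fin n → ℝ≥0∞
  | 0, _ => ⊤
  | k + 1, v => F.target k v

open Classical in
/-- The nodes of `layer k` of smaller value than `a` at `v`. -/
noncomputable def below (F : Broadcast n) (k : ℕ) (v : Fin n) (a : ℝ≥0∞) : Finset (Fin n) :=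
  {b ∈ F.layer k | F.val b v < a}

open Classical in
/-- The rounds below `r` in which `v` sends a message. -/
noncomputable def sendRounds (F : Broadcast n) (v : Fin n) (r : ℕ) : Finset ℕ :=
  {ρ ∈ Finset.range r | F.sent ρ (F.run ρ) v ≠ none}

theorem out_eq_priorTarget (hn : 0 < n) (k : ℕ) (v : Fin n) :
    (F.run (k * n)).out v = F.priorTarget k v := by
  cases k with
  | zero => simp [run, priorTarget]
  | succ k => exact out_eq_target hn k v

theorem card_sendRounds_succ_of_none (h : F.sent ρ (F.run ρ) v = none) :
    (F.sendRounds v (ρ + 1)).card = (F.sendRounds v ρ).card := by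
  simp [sendRounds, Finset.range_add_one, Finset.filter_insert, h]

theorem card_sendRounds_succ_of_some (h : F.sent ρ (F.run ρ) v = some b) :
    (F.sendRounds v (ρ + 1)).card = (F.sendRounds v ρ).card + 1 := by
  simp [sendRounds, Finset.range_add_one, Finset.filter_insert, h]

theorem card_sendRounds_succ_le (ρ : ℕ) (v : Fin n) :
    (F.sendRounds v (ρ + 1)).card ≤ (F.sendRounds v ρ).card + 1 := by
  cases h : F.sent ρ (F.run ρ) v with
  | none => rw [card_sendRounds_succ_of_none h]; omega
  | some b => rw [card_sendRounds_succ_of_some h]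

/-- From the third round of iteration `k` on, every message that `v` sends uses up one of the nodes
whose value is below `out`. -/
theorem card_sendRounds_add_card_below_le (r : ℕ) (hr : 2 ≤ r) (hrn : r ≤ n) :
    (F.sendRounds v (k * n + r)).card + (F.below k v ((F.run (k * n + r)).out v)).card ≤
      (F.sendRounds v (k * n + 2)).card + (F.below k v ((F.run (k * n + 2)).out v)).card := by
  classical
  induction r, hr using Nat.le_induction with
  | base => exact le_rfl
  | succ r hr ih =>
    have ih := ih (by omega)
    have h0 : (k * n + r) % n ≠ 0 := by
      rw [Nat.mul_add_mod_of_lt (by omega)]; omega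
    have hk : k * n + r < (k + 1) * n := by rw [add_mul]; omega
    rw [← add_assoc]
    cases hs : F.sent (k * n + r) (F.run (k * n + r)) v with
    | none =>
      rw [card_sendRounds_succ_of_none hs, run, step_out_of_not_sent hs]
      exact ih
    | some b =>
      obtain ⟨-, hlt⟩ := sent_filter h0 hs
      rw [card_sendRounds_succ_of_some hs, run, step_out_of_sent hs]
      have hcard : (F.below k v (F.val b v)).card <
          (F.below k v ((F.run (k * n + r)).out v)).card := by
        refine Finset.card_lt_card ((Finset.ssubset_iff_of_subset fun b' hb' => ?_).2
          ⟨b, by simp [below, hlt, sent_mem_layer hk hs], by simp [below]⟩)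
        simp only [below, Finset.mem_filter] at hb' ⊢
        exact ⟨hb'.1, hb'.2.trans hlt⟩
      omega

theorem out_le_priorTarget (hn : 2 ≤ n) (k : ℕ) (v : Fin n) :
    (F.run (k * n + 2)).out v ≤ F.priorTarget k v := by
  rw [← out_eq_priorTarget (by omega)]
  have h1 : (k * n + 1) % n ≠ 0 := by
    rw [Nat.mul_add_mod_of_lt (by omega)]; omega
  have hstep : (F.run (k * n + 2)).out v ≤ (F.run (k * n + 1)).out v := step_out_le h1 _ _
  cases hs : F.sent (k * n) (F.run (k * n)) v with
  | none =>
    refine hstep.trans_eq ?_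
    rw [run, step_out_of_not_sent hs]
  | some b =>
    obtain ⟨rfl, hl⟩ := sent_start (by simp) hs
    -- `v` has reset `out` to its own estimate; the messages received before undo this.
    obtain hle | ⟨b', hb', hle⟩ := est_le_out_or_exists_heard (F := F) (k * n) b
    · refine hstep.trans (le_of_eq_of_le ?_ hle)
      rw [run, step_out_of_sent hs, val_self hl]
    · exact (step_out_le_val h1 (heard_subset_step _ _ _ hb')).trans hle

theorem card_sendRounds_iteration_le (hn : 2 ≤ n) (k : ℕ) (v : Fin n) :
    (F.sendRounds v ((k + 1) * n)).card ≤
      (F.sendRounds v (k * n)).card + (F.below k v (F.priorTarget k v)).card + 2 := by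
  have h1 := card_sendRounds_add_card_below_le (F := F) (k := k) (v := v) n hn le_rfl
  have h2 := card_sendRounds_succ_le (F := F) (k * n) v
  have h3 := card_sendRounds_succ_le (F := F) (k * n + 1) v
  have h4 : (F.below k v ((F.run (k * n + 2)).out v)).card ≤
      (F.below k v (F.priorTarget k v)).card := by
    refine Finset.card_le_card fun b hb => ?_
    simp only [below, Finset.mem_filter] at hb ⊢
    exact ⟨hb.1, hb.2.trans_le (out_le_priorTarget hn k v)⟩
  rw [← Nat.succ_mul] at h1
  simp only [Nat.succ_eq_add_one] at h1
  rw [show k * n + 1 + 1 = k * n + 2 from rfl] at h3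
  omega

/-- If few nodes of each layer beat all nodes of the layer before, then few messages are sent. -/
theorem card_sendRounds_le (hn : 2 ≤ n) (v : Fin n) (K z : ℕ)
    (h : ∀ k < K, (F.below k v (F.priorTarget k v)).card ≤ z) :
    (F.sendRounds v (K * n)).card ≤ K * (z + 2) := by
  induction K with
  | zero => simp [sendRounds]
  | succ K ih =>
    have h1 := ih fun k hk => h k (by omega)
    have h2 := card_sendRounds_iteration_le (F := F) hn K v
    have h3 := h K (by omega)
    rw [add_mul K 1 (z + 2)]
    omega

end Broadcast

end CongestAPSP

/-! ### The Bellman–Ford step of the node program -/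

namespace CongestAPSP

variable {n : ℕ}

/-- The sources of a phase in the order in which Bellman–Ford is run from them. -/
def sourceList (src : Finset (Fin n)) : List (Fin n) := (List.finRange n).filter (· ∈ src)

theorem nodup_sourceList (src : Finset (Fin n)) : (sourceList src).Nodup :=
  (List.nodup_finRange n).filter _

theorem mem_sourceList {src : Finset (Fin n)} {s : Fin n} : s ∈ sourceList src ↔ s ∈ src := by
  simp [sourceList]

theorem length_sourceList (src : Finset (Fin n)) : (sourceList src).length = src.card := by
  rw [← List.toFinset_card_of_nodup (nodup_sourceList src)]
  congr 1
  ext s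
  simp [mem_sourceList]

theorem bfSource_eq (c i : ℕ) (src : Finset (Fin n)) (t : ℕ) :
    bfSource c i src t = (sourceList src)[t / depth n c i]? := by
  rw [bfSource, sourceList]

/-- The number of rounds that Bellman–Ford from `s` has carried out before round `t`. -/
def hopsBefore (h : ℕ) (src : Finset (Fin n)) (s : Fin n) (t : ℕ) : ℕ :=
  min h (t - (sourceList src).idxOf s * h)

section hopsBefore

variable {h t : ℕ} {src : Finset (Fin n)} {s s₀ : Fin n}

theorem idxOf_of_getElem? (hs : (sourceList src)[t]? = some s) : (sourceList src).idxOf s = t := by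
  obtain ⟨ht, rfl⟩ := List.getElem?_eq_some_iff.1 hs
  exact (nodup_sourceList src).idxOf_getElem t ht

theorem hopsBefore_current (hh : 0 < h) (hs : (sourceList src)[t / h]? = some s) :
    hopsBefore h src s t = t % h ∧ hopsBefore h src s (t + 1) = t % h + 1 := by
  have hi := idxOf_of_getElem? hs
  have h1 := Nat.div_add_mod' t h
  have h2 := Nat.mod_lt t hh
  rw [hopsBefore, hopsBefore, hi]
  omega

theorem hopsBefore_other (hh : 0 < h) (hs₀ : (sourceList src)[t / h]? = some s₀)
    (hs : s ∈ src) (hne : s ≠ s₀) : hopsBefore h src s (t + 1) = hopsBefore h src s t := by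
  have h1 := Nat.div_add_mod' t h
  have h2 := Nat.mod_lt t hh
  simp only [hopsBefore]
  set a := (sourceList src).idxOf s with ha
  have hlt : a < (sourceList src).length := List.idxOf_lt_length_iff.2 (mem_sourceList.2 hs)
  have hget : (sourceList src)[a] = s := List.getElem_idxOf hlt
  have hat : a ≠ t / h := by
    intro hat
    rw [← hat, List.getElem?_eq_getElem hlt, hget] at hs₀
    exact hne (Option.some_injective _ hs₀)
  rcases lt_or_gt_of_ne hat with hlt | hlt
  · have : (a + 1) * h ≤ t / h * h := Nat.mul_le_mul_right h hlt
    rw [add_mul] at this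
    omega
  · have : (t / h + 1) * h ≤ a * h := Nat.mul_le_mul_right h hlt
    rw [add_mul] at this
    omega

theorem hopsBefore_end (hs : s ∈ src) : hopsBefore h src s (src.card * h) = h := by
  have hlt : (sourceList src).idxOf s < (sourceList src).length :=
    List.idxOf_lt_length_iff.2 (mem_sourceList.2 hs)
  rw [length_sourceList] at hlt
  have : ((sourceList src).idxOf s + 1) * h ≤ src.card * h := Nat.mul_le_mul_right h hlt
  rw [add_mul] at this
  rw [hopsBefore]
  omega

end hopsBefore

/-- Taking in the messages of the nodes in `l`. -/
noncomputable def absorbAll (msgs : Fin n → Option (PhaseMsg n)) (l : List (Fin n))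
    (st : PhaseState n) : PhaseState n :=
  l.foldl (fun st' u => match msgs u with
        | none => st'
        | some m => absorb st' u m) st

theorem absorbAll_concat (msgs : Fin n → Option (PhaseMsg n)) (l : List (Fin n)) (u : Fin n)
    (st : PhaseState n) : absorbAll msgs (l ++ [u]) st = match msgs u with
        | none => absorbAll msgs l st
        | some m => absorb (absorbAll msgs l st) u m := by
  simp [absorbAll]

theorem absorb_queue (st : PhaseState n) (u : Fin n) (m : PhaseMsg n) :
    (absorb st u m).queue = st.queue := by
  cases m with
  | bf s d δ => simp only [absorb]; split_ifs <;> rfl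
  | fb => rfl

theorem absorbAll_queue (msgs : Fin n → Option (PhaseMsg n)) (l : List (Fin n))
    (st : PhaseState n) : (absorbAll msgs l st).queue = st.queue := by
  induction l using List.reverseRecOn with
  | nil => rfl
  | append_singleton l u ih =>
    rw [absorbAll_concat]
    cases msgs u with
    | none => exact ih
    | some m => rw [absorb_queue, ih]

/-- The effect of one round of Bellman–Ford messages from the source `s₀`. -/
structure BFUpdate (msgs : Fin n → Option (PhaseMsg n)) (s₀ : Fin n) (l : List (Fin n))
    (st st' : PhaseState n) : Prop where
  inp : st'.inp = st.inp
  est : st'.est = st.est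
  out : st'.out = st.out
  dhat_other : ∀ s, s ≠ s₀ → st'.dhat s = st.dhat s
  startOf_other : ∀ s, s ≠ s₀ → st'.startOf s = st.startOf s
  dhat_le : st'.dhat s₀ ≤ st.dhat s₀
  dhat_le_msg : ∀ u ∈ l, ∀ d δ, msgs u = some (.bf s₀ d δ) → st'.dhat s₀ ≤ d + st.inp.inLen u
  cases : (st'.dhat s₀ = st.dhat s₀ ∧ st'.startOf s₀ = st.startOf s₀) ∨
    (st'.fresh = true ∧ ∃ u d δ, msgs u = some (.bf s₀ d δ) ∧
      st'.dhat s₀ = d + st.inp.inLen u ∧ st'.dhat s₀ < ⊤ ∧ st'.startOf s₀ = some δ)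

theorem absorbAll_bfUpdate {msgs : Fin n → Option (PhaseMsg n)} {s₀ : Fin n}
    (hm : ∀ u m, msgs u = some m → ∃ d δ, m = .bf s₀ d δ) (l : List (Fin n))
    (st : PhaseState n) : BFUpdate msgs s₀ l st (absorbAll msgs l st) := by
  induction l using List.reverseRecOn with
  | nil => exact ⟨rfl, rfl, rfl, fun _ _ => rfl, fun _ _ => rfl, le_rfl, by simp, Or.inl ⟨rfl, rfl⟩⟩
  | append_singleton l u ih =>
    rw [absorbAll_concat]
    set st' := absorbAll msgs l st with hst'
    cases hu : msgs u with
    | none =>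
      refine ⟨ih.inp, ih.est, ih.out, ih.dhat_other, ih.startOf_other, ih.dhat_le, ?_, ih.cases⟩
      intro u' hu' d δ hd
      rcases List.mem_append.1 hu' with hu' | hu'
      · exact ih.dhat_le_msg u' hu' d δ hd
      · rw [List.mem_singleton] at hu'
        subst hu'
        rw [hu] at hd
        exact absurd hd (by simp)
    | some m =>
      obtain ⟨d, δ, rfl⟩ := hm u m hu
      by_cases hlt : d + st'.inp.inLen u < st'.dhat s₀
      · have heq : absorb st' u (.bf s₀ d δ) = { st' with
            dhat := Function.update st'.dhat s₀ (d + st'.inp.inLen u)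
            startOf := Function.update st'.startOf s₀ (some δ)
            fresh := true } := if_pos hlt
        simp only [heq]
        refine ⟨ih.inp, ih.est, ih.out, ?_, ?_, ?_, ?_, Or.inr ⟨rfl, u, d, δ, hu, ?_, ?_, ?_⟩⟩
        · intro s hs
          simpa [hs] using ih.dhat_other s hs
        · intro s hs
          simpa [hs] using ih.startOf_other s hs
        · simpa using hlt.le.trans ih.dhat_le
        · intro u' hu' d' δ' hd'
          simp only [Function.update_self]
          rcases List.mem_append.1 hu' with hu' | hu'
          · exact hlt.le.trans (ih.dhat_le_msg u' hu' d' δ' hd')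
          · rw [List.mem_singleton] at hu'
            subst hu'
            rw [hu] at hd'
            obtain ⟨rfl, rfl⟩ : d = d' ∧ δ = δ' := by simpa using hd'
            rw [ih.inp]
        · simp [ih.inp]
        · simpa using hlt.trans_le le_top
        · simp
      · have heq : absorb st' u (.bf s₀ d δ) = st' := if_neg hlt
        simp only [heq]
        refine ⟨ih.inp, ih.est, ih.out, ih.dhat_other, ih.startOf_other, ih.dhat_le, ?_, ih.cases⟩
        intro u' hu' d' δ' hd'
        rcases List.mem_append.1 hu' with hu' | hu'
        · exact ih.dhat_le_msg u' hu' d' δ' hd'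
        · rw [List.mem_singleton] at hu'
          subst hu'
          rw [hu] at hd'
          obtain ⟨rfl, rfl⟩ : d = d' ∧ δ = δ' := by simpa using hd'
          exact ih.inp ▸ not_lt.1 hlt

section Phase

variable (N : Network n) (c κ : ℕ) (tie : Fin n → Fin n → Finset (Fin n) → Fin n)
  (i : Fin (lg n + 1)) (ω : Coins n)

/-- The state of node `v` at the beginning of round `t` of phase `i`. -/
noncomputable def phaseConfig (t : ℕ) (v : Fin n) : PhaseState n :=
  (phaseProtocol c κ i tie).config N (phaseInput N i ω) t v

open Classical in
theorem phaseConfig_succ (t : ℕ) (v : Fin n) :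
    phaseConfig N c κ tie i ω (t + 1) v =
      absorbAll (fun u => if N.graph.Adj u v then (phaseProtocol c κ i tie).send t
          ((phaseProtocol c κ i tie).wake t (phaseConfig N c κ tie i ω t u)) else none)
        (List.finRange n)
        { (phaseProtocol c κ i tie).wake t (phaseConfig N c κ tie i ω t v) with
          fresh := false } := rfl

open Classical in
/-- The state of node `v` before round `t` of the Bellman–Ford step.  The last clause says that a
node that is not `fresh` has not improved in the round before. -/
structure BFState (t : ℕ) (v : Fin n) (st : PhaseState n) : Prop where
  inp : st.inp = phaseInput N i ω v
  est : ∀ s b, st.est s b = ⊤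
  out : ∀ s, st.out s = ⊤
  dhat : ∀ s, st.dhat s = if s ∈ sampled ω i then
    N.hopDist (hopsBefore (depth n c i) (sampled ω i) s t) s v else ⊤
  startOf : ∀ s, st.startOf s = if st.dhat s = ⊤ then none else some (startDelay ω i s)
  not_fresh : t % depth n c i ≠ 0 → ∀ s, (sourceList (sampled ω i))[t / depth n c i]? = some s →
    st.fresh = false →
      N.hopDist (t % depth n c i) s v = N.hopDist (t % depth n c i - 1) s v

/-- Bellman–Ford from the `q`-th source takes the rounds from `q * h` to `(q + 1) * h`, where
`h = depth n c i`, and its first `r` rounds take the walks with up to `r` edges into account. -/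
theorem bfState_phaseConfig (hd : 0 < depth n c i) (t : ℕ)
    (ht : t ≤ bfRounds n c i (sampled ω i).card) (v : Fin n) :
    BFState N c i ω t v (phaseConfig N c κ tie i ω t v) := by
  induction t generalizing v with
  | zero =>
    have hdhat : ∀ s, (phaseConfig N c κ tie i ω 0 v).dhat s =
        if s = v ∧ s ∈ sampled ω i then 0 else ⊤ := fun s => rfl
    refine ⟨rfl, fun _ _ => rfl, fun _ => rfl, fun s => ?_, fun s => ?_, fun h => ?_⟩
    · simp only [hdhat, hopsBefore, zero_tsub, min_zero, Network.hopDist_zero]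
      split_ifs <;> grind
    · rw [hdhat]
      change (if s = v ∧ s ∈ sampled ω i then some (startDelay ω i v) else none) = _
      by_cases h : s = v ∧ s ∈ sampled ω i
      · simp [h]
      · simp [h]
    · simp at h
  | succ t ih =>
    have ih := fun v => ih (by omega) v
    rw [Nat.succ_le_iff] at ht
    have hwake : ∀ v, (phaseProtocol c κ i tie).wake t (phaseConfig N c κ tie i ω t v) =
        phaseConfig N c κ tie i ω t v := by
      intro v
      refine if_neg ?_
      rw [(ih v).inp]
      exact fun h => absurd h.1 (not_le.2 ht)
    have hlt : t / depth n c i < (sourceList (sampled ω i)).length := by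
      rw [length_sourceList]
      exact Nat.div_lt_of_lt_mul (by rw [mul_comm]; exact ht)
    obtain ⟨s₀, hs₀⟩ : ∃ s₀, (sourceList (sampled ω i))[t / depth n c i]? = some s₀ :=
      ⟨_, List.getElem?_eq_getElem hlt⟩
    have hs₀mem : s₀ ∈ sampled ω i := mem_sourceList.1 (List.mem_of_getElem? hs₀)
    obtain ⟨hop, hop'⟩ := hopsBefore_current hd hs₀
    have hsend : ∀ u, (phaseProtocol c κ i tie).send t (phaseConfig N c κ tie i ω t u) =
        if t % depth n c i = 0 ∨ (phaseConfig N c κ tie i ω t u).fresh = true then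
          some (.bf s₀ ((phaseConfig N c κ tie i ω t u).dhat s₀)
            (((phaseConfig N c κ tie i ω t u).startOf s₀).getD 0)) else none := by
      intro u
      have hb : bfSource c i (phaseConfig N c κ tie i ω t u).inp.src t = some s₀ := by
        rw [(ih u).inp, bfSource_eq]; exact hs₀
      have hlt' : t < bfRounds n c i (phaseConfig N c κ tie i ω t u).inp.src.card := by
        rw [(ih u).inp]; exact ht
      simp only [phaseProtocol, hlt', if_true, hb]
    rw [phaseConfig_succ]
    simp only [hwake, hsend]
    classical
    set msgs : Fin n → Option (PhaseMsg n) := fun u => if N.graph.Adj u v then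
      (if t % depth n c i = 0 ∨ (phaseConfig N c κ tie i ω t u).fresh = true then
          some (.bf s₀ ((phaseConfig N c κ tie i ω t u).dhat s₀)
            (((phaseConfig N c κ tie i ω t u).startOf s₀).getD 0)) else none) else none with hmsgs
    set st : PhaseState n := { phaseConfig N c κ tie i ω t v with fresh := false } with hst
    have hdhat : ∀ u, (phaseConfig N c κ tie i ω t u).dhat s₀ =
        N.hopDist (t % depth n c i) s₀ u := fun u => by
      rw [(ih u).dhat, if_pos hs₀mem, hop]
    have hmsg : ∀ u d δ, msgs u = some (.bf s₀ d δ) → N.graph.Adj u v ∧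
        d = N.hopDist (t % depth n c i) s₀ u ∧ (d ≠ ⊤ → δ = startDelay ω i s₀) := by
      intro u d δ h
      simp only [hmsgs] at h
      split_ifs at h with h1 h2
      obtain ⟨rfl, rfl⟩ : _ = d ∧ _ = δ := by simpa using h
      refine ⟨h1, hdhat u, fun hne => ?_⟩
      rw [(ih u).startOf, if_neg hne]
      rfl
    have hU : BFUpdate msgs s₀ (List.finRange n) st (absorbAll msgs (List.finRange n) st) := by
      refine absorbAll_bfUpdate (fun u m h => ?_) _ _
      simp only [hmsgs] at h
      split_ifs at h
      exact ⟨_, _, (Option.some_injective _ h).symm⟩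
    have hinLen : ∀ u, st.inp.inLen u = N.len u v := fun u => by
      change (phaseConfig N c κ tie i ω t v).inp.inLen u = _
      rw [(ih v).inp]
      rfl
    set st' := absorbAll msgs (List.finRange n) st
    have hst0 : st.dhat s₀ = N.hopDist (t % depth n c i) s₀ v := hdhat v
    have hnew : st'.dhat s₀ = N.hopDist (t % depth n c i + 1) s₀ v := by
      refine le_antisymm (Network.le_hopDist_succ (hst0 ▸ hU.dhat_le) fun u => ?_) ?_
      · by_cases hadj : N.graph.Adj u v
        · by_cases hs : t % depth n c i = 0 ∨ (phaseConfig N c κ tie i ω t u).fresh = true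
          · have hu : msgs u = _ := (if_pos hadj).trans (if_pos hs)
            have := hU.dhat_le_msg u (List.mem_finRange u) _ _ hu
            rwa [hdhat, hinLen] at this
          · -- A node that does not send has not improved, and what it sent before is still valid.
            push Not at hs
            have hnf := (ih u).not_fresh hs.1 s₀ hs₀ (by simpa using hs.2)
            refine hU.dhat_le.trans ?_
            have hle := Network.hopDist_succ_le (N := N) (t % depth n c i - 1) s₀ u v
            rwa [Nat.sub_add_cancel (Nat.one_le_iff_ne_zero.2 hs.1), ← hst0, ← hnf] at hle
        · simp [Network.len_of_not_adj hadj]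
      · obtain ⟨h, -⟩ | ⟨-, u, d, δ, hu, h, -⟩ := hU.cases
        · rw [h, hst0]
          exact Network.hopDist_antitone s₀ v (Nat.le_succ _)
        · rw [h, (hmsg u d δ hu).2.1, hinLen]
          exact Network.hopDist_succ_le _ _ _ _
    refine ⟨hU.inp.trans (ih v).inp, fun s b => ?_, fun s => ?_, fun s => ?_, fun s => ?_, ?_⟩
    · rw [hU.est]; exact (ih v).est s b
    · rw [hU.out]; exact (ih v).out s
    · by_cases hs : s = s₀
      · subst hs
        rw [hnew, if_pos hs₀mem, hop']
      · rw [hU.dhat_other s hs]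
        refine ((ih v).dhat s).trans ?_
        split_ifs with hmem
        · rw [hopsBefore_other hd hs₀ hmem hs]
        · rfl
    · by_cases hs : s = s₀
      · subst hs
        obtain ⟨h1, h2⟩ | ⟨-, u, d, δ, hu, h1, h2, h3⟩ := hU.cases
        · rw [h1, h2]; exact (ih v).startOf s
        · rw [h3, if_neg h2.ne, (hmsg u d δ hu).2.2]
          rintro rfl
          simp [h1] at h2
      · rw [hU.dhat_other s hs, hU.startOf_other s hs]
        exact (ih v).startOf s
    · intro hmod s hs hf
      have h1 := Nat.div_add_mod' t (depth n c i)
      have h2 := Nat.mod_lt t hd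
      have hlt : t % depth n c i + 1 < depth n c i := by
        by_contra hge
        refine hmod ?_
        rw [show t + 1 = (t / depth n c i + 1) * depth n c i by rw [add_mul]; omega]
        exact Nat.mul_mod_left _ _
      have hdiv : (t + 1) / depth n c i = t / depth n c i := by
        rw [Nat.div_eq_iff hd]
        omega
      have hm : (t + 1) % depth n c i = t % depth n c i + 1 := by
        have := Nat.div_add_mod' (t + 1) (depth n c i)
        rw [hdiv] at this
        omega
      rw [hdiv, hs₀] at hs
      obtain rfl : s₀ = s := Option.some_injective _ hs
      rw [hm, Nat.add_sub_cancel, ← hnew]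
      obtain ⟨h, -⟩ | ⟨h, -⟩ := hU.cases
      · rw [h, hst0]
      · rw [h] at hf
        exact absurd hf (by simp)

end Phase

end CongestAPSP

/-! ### The parallel filtered broadcasts of the node program -/

namespace CongestAPSP

variable {n : ℕ}

section Phase

variable (N : Network n) (c κ : ℕ) {tie : Fin n → Fin n → Finset (Fin n) → Fin n}
  (htie : ∀ v s A, A.Nonempty → tie v s A ∈ A)
  (i : Fin (lg n + 1)) (ω : Coins n)

open Classical in
/-- The result of the Bellman–Ford step, `∞` for a node `s` that is not a source. -/
noncomputable def estimate (s v : Fin n) : ℝ≥0∞ :=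
  if s ∈ sampled ω i then N.hopDist (depth n c i) s v else ⊤

theorem between_subset (s : Fin n) (j : ℕ) : between ω i s j ⊆ sampled ω (i + 1) :=
  Finset.filter_subset _ _

theorem between_zero (s : Fin n) : between ω i s 0 = sampled ω (i + 1) := by
  simp [between]

theorem between_antitone (s : Fin n) : Antitone (between ω i s) := fun j j' hj b hb => by
  simp only [between, Finset.mem_filter] at hb ⊢
  exact ⟨hb.1, fun l hl => hb.2 l (hl.trans_le hj)⟩

theorem known_of_mem_sampled {b : Fin n} (hb : b ∈ sampled ω (i + 1)) (v : Fin n) :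
    (phaseInput N i ω v).known b = N.dist b v := by
  refine if_pos ?_
  simp only [sampledFrom, Finset.mem_filter, Finset.mem_univ, true_and]
  exact ⟨_, le_rfl, hb⟩

/-- The filtered broadcast from `s` in phase `i`.  For a node `s` that is not a source, nobody ever
takes part in it. -/
noncomputable def bcast (s : Fin n) : Broadcast n where
  net := N
  est := estimate N c i ω s
  known b v := (phaseInput N i ω v).known b
  layer k := between ω i s (lg n - k)
  tie v A := tie v s A
  tie_mem v A hA := htie v s A hA
  layer_mono _ _ hk := between_antitone i ω s (Nat.sub_le_sub_left hk _)
  known_eq _ _ hb := known_of_mem_sampled N i ω (between_subset i ω s _ hb)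

/-- The message `M(s, b)`. -/
noncomputable def fbMsg (s b : Fin n) : PhaseMsg n :=
  .fb s b (estimate N c i ω s b) (startDelay ω i s)

theorem fbMsg_inj {s b s' b' : Fin n} (h : fbMsg N c i ω s b = fbMsg N c i ω s' b') :
    s = s' ∧ b = b' := by
  simp only [fbMsg, PhaseMsg.fb.injEq] at h
  exact ⟨h.1, h.2.1⟩

open Classical in
/-- The state `st` of node `v` during the second step has the values `out s` for the source `s`,
and the messages `M(s, b)` with `b ∈ heard s` have been received. -/
structure FBState (v : Fin n) (out : Fin n → ℝ≥0∞) (heard : Fin n → Set (Fin n))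
    (st : PhaseState n) : Prop where
  inp : st.inp = phaseInput N i ω v
  dhat : ∀ s, st.dhat s = estimate N c i ω s v
  out_eq : ∀ s, st.out s = out s
  est : ∀ s b, st.est s b = if b ∈ heard s then estimate N c i ω s b else ⊤
  startOf : ∀ s, st.startOf s =
    if estimate N c i ω s v ≠ ⊤ ∨ (heard s).Nonempty then some (startDelay ω i s) else none

variable {N c κ i ω}

theorem FBState.absorb {v : Fin n} {out : Fin n → ℝ≥0∞} {heard : Fin n → Set (Fin n)}
    {st : PhaseState n} (h : FBState N c i ω v out heard st) (u s b : Fin n) :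
    FBState N c i ω v out (fun s' => heard s' ∪ {b' | s' = s ∧ b' = b})
      (absorb st u (fbMsg N c i ω s b)) where
  inp := h.inp
  dhat := h.dhat
  out_eq := h.out_eq
  est s' b' := by
    classical
    change Function.update st.est s (Function.update (st.est s) b (estimate N c i ω s b)) s' b' = _
    by_cases hs : s' = s
    · subst hs
      by_cases hb : b' = b
      · subst hb
        have hb : b' ∈ heard s' ∪ {b | s' = s' ∧ b = b'} := Or.inr ⟨rfl, rfl⟩
        rw [Function.update_self, Function.update_self, if_pos hb]
      · rw [Function.update_self, Function.update_of_ne hb, h.est]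
        split_ifs <;> simp_all
    · rw [Function.update_of_ne hs, h.est]
      split_ifs <;> simp_all
  startOf s' := by
    classical
    change Function.update st.startOf s (some (startDelay ω i s)) s' = _
    by_cases hs : s' = s
    · subst hs
      have hne : estimate N c i ω s' v ≠ ⊤ ∨ (heard s' ∪ {b' | s' = s' ∧ b' = b}).Nonempty :=
        Or.inr ⟨b, Or.inr ⟨rfl, rfl⟩⟩
      rw [Function.update_self, if_pos hne]
    · rw [Function.update_of_ne hs, h.startOf]
      exact if_congr (by simp [hs]) rfl rfl

theorem FBState.absorbAll {v : Fin n} {out : Fin n → ℝ≥0∞} {heard : Fin n → Set (Fin n)}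
    {st : PhaseState n} (h : FBState N c i ω v out heard st)
    {msgs : Fin n → Option (PhaseMsg n)}
    (hm : ∀ u m, msgs u = some m → ∃ s b, m = fbMsg N c i ω s b) (l : List (Fin n)) :
    FBState N c i ω v out
      (fun s => heard s ∪ {b | ∃ u ∈ l, msgs u = some (fbMsg N c i ω s b)})
      (absorbAll msgs l st) := by
  induction l using List.reverseRecOn with
  | nil => simpa [CongestAPSP.absorbAll] using h
  | append_singleton l u ih =>
    rw [absorbAll_concat]
    cases hu : msgs u with
    | none =>
      convert ih using 4 with s
      ext b
      simp [hu, or_and_right, exists_or]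
    | some m =>
      obtain ⟨s, b, rfl⟩ := hm u m hu
      convert ih.absorb u s b using 2 with s'
      rw [Set.union_assoc]
      congr 1
      ext b'
      simp only [List.mem_append, List.mem_singleton, or_and_right, exists_or,
        exists_eq_left, hu, Set.mem_union, Set.mem_ofPred_eq, Option.some.injEq]
      refine or_congr Iff.rfl ⟨fun h => ?_, ?_⟩
      · exact (fbMsg_inj N c i ω h).imp Eq.symm Eq.symm
      · rintro ⟨rfl, rfl⟩
        rfl

theorem FBState.fresh {v : Fin n} {out : Fin n → ℝ≥0∞} {heard : Fin n → Set (Fin n)}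
    {st : PhaseState n} (h : FBState N c i ω v out heard st) (f : Bool) :
    FBState N c i ω v out heard { st with fresh := f } :=
  ⟨h.inp, h.dhat, h.out_eq, h.est, h.startOf⟩

variable (N c i ω) in
open Classical in
/-- The node `b` for which `u` sends `M(s, b)` in frame `β`, if any, provided that no message is
lost.  The broadcast from `s` is under way for `fbRounds n` frames from its start delay on. -/
noncomputable def sentInFrame (β : ℕ) (s u : Fin n) : Option (Fin n) :=
  if startDelay ω i s ≤ β ∧ β < startDelay ω i s + fbRounds n then
    (bcast N c htie i ω s).sent (β - startDelay ω i s)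
      ((bcast N c htie i ω s).run (β - startDelay ω i s)) u
  else none

variable (N c i ω) in
/-- The state before frame `β` of the broadcast from `s` if no message is lost. -/
noncomputable def stateAt (β : ℕ) (s : Fin n) : Broadcast.State n :=
  (bcast N c htie i ω s).run (min (fbRounds n) (β - startDelay ω i s))

theorem stateAt_succ_out (β : ℕ) (s v : Fin n) :
    (stateAt N c htie i ω (β + 1) s).out v =
      (sentInFrame N c htie i ω β s v).elim
        ((stateAt N c htie i ω β s).out v)
        fun b => (bcast N c htie i ω s).val b v := by
  by_cases h : startDelay ω i s ≤ β ∧ β < startDelay ω i s + fbRounds n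
  · have h1 : min (fbRounds n) (β + 1 - startDelay ω i s) = β - startDelay ω i s + 1 := by omega
    have h2 : min (fbRounds n) (β - startDelay ω i s) = β - startDelay ω i s := by omega
    simp only [stateAt, sentInFrame, h1, h2, if_pos h]
    rfl
  · have h1 : min (fbRounds n) (β + 1 - startDelay ω i s) =
      min (fbRounds n) (β - startDelay ω i s) := by omega
    simp only [stateAt, sentInFrame, h1, if_neg h]
    rfl

theorem stateAt_succ_heard (β : ℕ) (s v : Fin n) :
    (stateAt N c htie i ω (β + 1) s).heard v =
      (stateAt N c htie i ω β s).heard v ∪ {b | ∃ u, N.graph.Adj u v ∧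
        sentInFrame N c htie i ω β s u = some b} := by
  by_cases h : startDelay ω i s ≤ β ∧ β < startDelay ω i s + fbRounds n
  · have h1 : min (fbRounds n) (β + 1 - startDelay ω i s) = β - startDelay ω i s + 1 := by omega
    have h2 : min (fbRounds n) (β - startDelay ω i s) = β - startDelay ω i s := by omega
    simp only [stateAt, sentInFrame, h1, h2, if_pos h]
    rfl
  · have h1 : min (fbRounds n) (β + 1 - startDelay ω i s) =
      min (fbRounds n) (β - startDelay ω i s) := by omega
    simp [stateAt, sentInFrame, h1, if_neg h]

theorem FBState.value_eq {v : Fin n} {out : Fin n → ℝ≥0∞} {heard : Fin n → Set (Fin n)}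
    {st : PhaseState n} (h : FBState N c i ω v out heard st) {s : Fin n} {σ : Broadcast.State n}
    (hσ : heard s = σ.heard v) : value st s = (bcast N c htie i ω s).score σ v := by
  funext b
  rw [value, h.est, h.inp, hσ]
  rfl

/-- A round of the filtered broadcast in the node program is a round of `bcast`. -/
theorem FBState.fbStep_eq {v : Fin n} {β : ℕ} {st : PhaseState n}
    (h : FBState N c i ω v (fun s => (stateAt N c htie i ω β s).out v)
      (fun s => (stateAt N c htie i ω β s).heard v) st) (s : Fin n) :
    fbStep tie β st s =
      ((stateAt N c htie i ω (β + 1) s).out v,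
        (sentInFrame N c htie i ω β s v).map (fbMsg N c i ω s)) := by
  rw [stateAt_succ_out]
  have hout := h.out_eq s
  have hstart := h.startOf s
  by_cases hβ : startDelay ω i s ≤ β ∧ β < startDelay ω i s + fbRounds n
  swap
  · rw [sentInFrame, if_neg hβ, fbStep, hstart, hout]
    split_ifs <;> simp [hβ]
  have h2 : min (fbRounds n) (β - startDelay ω i s) = β - startDelay ω i s := by omega
  rw [sentInFrame, if_pos hβ]
  have hrun : stateAt N c htie i ω β s =
      (bcast N c htie i ω s).run (β - startDelay ω i s) := by rw [stateAt, h2]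
  have hest := h.est s
  rw [hrun] at hout hstart ⊢
  have hval := h.value_eq htie (s := s)
    (σ := (bcast N c htie i ω s).run (β - startDelay ω i s)) (by rw [hrun])
  set F := bcast N c htie i ω s with hF
  set ρ := β - startDelay ω i s with hρ
  set σ := F.run ρ with hσ
  by_cases hact : F.Active σ v
  swap
  · have hnone : st.startOf s = none := by rw [hstart]; exact if_neg hact
    have hsent : F.sent ρ σ v = none := if_neg hact
    rw [hsent, fbStep, hnone, hout]
    rfl
  have hsome : st.startOf s = some (startDelay ω i s) := by rw [hstart]; exact if_pos hact
  have hid : st.inp.id = v := by rw [h.inp]; rfl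
  have hbest : best st s = Broadcast.minimizers (F.score σ v) := by
    ext b
    simp [best, Broadcast.mem_minimizers, hval]
  have hpick : tie st.inp.id s (best st s) = F.pick σ v := by rw [hid, hbest]; rfl
  rw [fbStep, hsome]
  simp only [hβ, and_self, if_true, hpick, hval, hout]
  by_cases h0 : ρ % n = 0
  · have hin : (st.inp.inBetween s (lg n - ρ / n) = true) ↔ v ∈ F.layer (ρ / n) := by
      rw [h.inp]
      exact decide_eq_true_iff
    by_cases hv : v ∈ F.layer (ρ / n)
    · have hs : F.sent ρ σ v = some v := by simp [Broadcast.sent, hact, h0, hv]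
      rw [← hρ, if_pos h0, if_pos (hin.2 hv), hs, h.dhat, hid]
      exact Prod.ext (Broadcast.val_self hv).symm rfl
    · have hs : F.sent ρ σ v = none := by simp [Broadcast.sent, h0, hv]
      rw [← hρ, if_pos h0, if_neg (hin.not.2 hv), hs]
      rfl
  · by_cases hlt : F.score σ v (F.pick σ v) < σ.out v
    · have hs : F.sent ρ σ v = some (F.pick σ v) := by
        simp [Broadcast.sent, hact, h0, hlt]
      have hmem := (Broadcast.sent_filter h0 hs).1
      rw [← hρ, if_neg h0, if_pos hlt, hs, hest, hrun, if_pos hmem, Broadcast.score_of_mem hmem]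
      rfl
    · have hs : F.sent ρ σ v = none := by simp [Broadcast.sent, h0, hlt]
      rw [← hρ, if_neg h0, if_neg hlt, hs]
      rfl

end Phase

end CongestAPSP

/-! ### Correctness of a phase in which every frame suffices for its messages -/

namespace CongestAPSP

variable {n : ℕ}

section Phase

variable {N : Network n} {c κ : ℕ} {tie : Fin n → Fin n → Finset (Fin n) → Fin n}
  (htie : ∀ v s A, A.Nonempty → tie v s A ∈ A)
  {i : Fin (lg n + 1)} {ω : Coins n}

variable (N c i ω) in
/-- The state `st` of node `v` before frame `β` is that of the loss-free broadcasts. -/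
def InFrame (β : ℕ) (v : Fin n) (st : PhaseState n) : Prop :=
  FBState N c i ω v (fun s => (stateAt N c htie i ω β s).out v)
    (fun s => (stateAt N c htie i ω β s).heard v) st

theorem inFrame_zero (hd : 0 < depth n c i) (v : Fin n) :
    InFrame N c htie i ω 0 v
      (phaseConfig N c κ tie i ω (bfRounds n c i (sampled ω i).card) v) := by
  have h := bfState_phaseConfig N c κ tie i ω hd _ le_rfl v
  have hrun : ∀ s, stateAt N c htie i ω 0 s =
      ⟨fun _ => ⊤, fun _ => ∅⟩ := fun s => by simp [stateAt, Broadcast.run]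
  have hdhat : ∀ s, (phaseConfig N c κ tie i ω (bfRounds n c i (sampled ω i).card) v).dhat s =
      estimate N c i ω s v := fun s => by
    rw [h.dhat, estimate]
    split_ifs with hs
    · rw [bfRounds, hopsBefore_end hs]
    · rfl
  refine ⟨h.inp, hdhat, fun s => ?_, fun s b => ?_, fun s => ?_⟩
  · rw [hrun]; exact h.out s
  · simp only [hrun]; simpa using h.est s b
  · have hheard : (stateAt N c htie i ω 0 s).heard v = ∅ := by
      rw [hrun]
    rw [hheard, h.startOf, hdhat]
    by_cases hx : estimate N c i ω s v = ⊤ <;> simp [hx]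

variable (N c i ω) in
/-- The messages that node `u` has to send in frame `β`. -/
noncomputable def frameQueue (β : ℕ) (u : Fin n) : List (PhaseMsg n) :=
  (List.finRange n).filterMap fun s =>
    (sentInFrame N c htie i ω β s u).map (fbMsg N c i ω s)

theorem mem_frameQueue {β : ℕ} {u s b : Fin n} : fbMsg N c i ω s b ∈ frameQueue N c htie i ω β u ↔
    sentInFrame N c htie i ω β s u = some b := by
  simp only [frameQueue, List.mem_filterMap, List.mem_finRange, true_and, Option.map_eq_some_iff]
  constructor
  · rintro ⟨s', b', h, heq⟩
    obtain ⟨rfl, rfl⟩ := fbMsg_inj N c i ω heq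
    exact h
  · exact fun h => ⟨s, b, h, rfl⟩

theorem exists_of_mem_frameQueue {β : ℕ} {u : Fin n} {m : PhaseMsg n}
    (h : m ∈ frameQueue N c htie i ω β u) : ∃ s b, m = fbMsg N c i ω s b := by
  simp only [frameQueue, List.mem_filterMap, Option.map_eq_some_iff] at h
  obtain ⟨s, -, b, -, rfl⟩ := h
  exact ⟨s, b, rfl⟩

variable (N c i ω) in
/-- The number of messages that node `u` has to send in frame `β`. -/
noncomputable def load (β : ℕ) (u : Fin n) : ℕ :=
  (Finset.univ.filter fun s =>
    (sentInFrame N c htie i ω β s u).isSome = true).card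

theorem length_frameQueue (β : ℕ) (u : Fin n) :
    (frameQueue N c htie i ω β u).length = load N c htie i ω β u := by
  rw [frameQueue, List.length_filterMap_eq_countP, List.countP_eq_length_filter, load,
    ← List.toFinset_card_of_nodup ((List.nodup_finRange n).filter _)]
  congr 1
  ext s
  simp

variable (N c i ω) in
/-- The state `st` of node `v` when the first `k` messages of every queue of frame `β` have
been delivered. -/
def WithinFrame (β k : ℕ) (v : Fin n) (st : PhaseState n) : Prop :=
  FBState N c i ω v (fun s => (stateAt N c htie i ω (β + 1) s).out v)
    (fun s => (stateAt N c htie i ω β s).heard v ∪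
      {b | ∃ u, N.graph.Adj u v ∧ ∃ j < k,
        (frameQueue N c htie i ω β u)[j]? = some (fbMsg N c i ω s b)}) st ∧
  st.queue = frameQueue N c htie i ω β v

theorem withinFrame_frameStep {β : ℕ} {v : Fin n} {st : PhaseState n}
    (h : InFrame N c htie i ω β v st) :
    WithinFrame N c htie i ω β 0 v (frameStep tie β st) := by
  have heq : (fun s => (stateAt N c htie i ω β s).heard v ∪
      {b | ∃ u, N.graph.Adj u v ∧ ∃ j < 0,
        (frameQueue N c htie i ω β u)[j]? = some (fbMsg N c i ω s b)}) =
      fun s => (stateAt N c htie i ω β s).heard v := by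
    funext s
    simp
  rw [WithinFrame, heq]
  refine ⟨⟨h.inp, h.dhat, fun s => ?_, h.est, h.startOf⟩, ?_⟩
  · exact congrArg Prod.fst (h.fbStep_eq htie s)
  · simp only [frameStep, frameQueue]
    congr 1
    funext s
    exact congrArg Prod.snd (h.fbStep_eq htie s)

theorem inFrame_of_withinFrame {β k : ℕ} {v : Fin n} {st : PhaseState n}
    (hk : ∀ u, load N c htie i ω β u ≤ k) (h : WithinFrame N c htie i ω β k v st) :
    InFrame N c htie i ω (β + 1) v st := by
  have heq : ∀ s, (stateAt N c htie i ω (β + 1) s).heard v =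
      (stateAt N c htie i ω β s).heard v ∪
      {b | ∃ u, N.graph.Adj u v ∧ ∃ j < k,
        (frameQueue N c htie i ω β u)[j]? = some (fbMsg N c i ω s b)} := fun s => by
    rw [stateAt_succ_heard]
    congr 1
    ext b
    refine exists_congr fun u => and_congr_right fun _ => ?_
    rw [← mem_frameQueue, List.mem_iff_getElem?]
    refine ⟨fun ⟨j, hj⟩ => ⟨j, ?_, hj⟩, fun ⟨j, _, hj⟩ => ⟨j, hj⟩⟩
    have := (List.getElem?_eq_some_iff.1 hj).1
    rw [length_frameQueue] at this
    exact this.trans_le (hk u)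
  rw [InFrame]
  simp only [heq]
  exact h.1

theorem withinFrame_phaseConfig_succ {β k t : ℕ}
    (hk : k < frameLen n κ) (hβ : β < numFrames n (sampled ω i).card)
    (ht : t = bfRounds n c i (sampled ω i).card + β * frameLen n κ + k)
    (h : ∀ v, WithinFrame N c htie i ω β k v
      ((phaseProtocol c κ i tie).wake t (phaseConfig N c κ tie i ω t v))) (v : Fin n) :
    WithinFrame N c htie i ω β (k + 1) v (phaseConfig N c κ tie i ω (t + 1) v) := by
  classical
  have hend : t < phaseEnd n c κ i (sampled ω i).card := by
    have : (β + 1) * frameLen n κ ≤ numFrames n (sampled ω i).card * frameLen n κ :=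
      Nat.mul_le_mul_right _ hβ
    rw [add_mul] at this
    rw [phaseEnd]
    omega
  have hmod : (t - bfRounds n c i (sampled ω i).card) % frameLen n κ = k := by
    rw [ht, add_assoc, Nat.add_sub_cancel_left, Nat.mul_add_mod_of_lt hk]
  have hsend : ∀ u, (phaseProtocol c κ i tie).send t
      ((phaseProtocol c κ i tie).wake t (phaseConfig N c κ tie i ω t u)) =
        (frameQueue N c htie i ω β u)[k]? := by
    intro u
    obtain ⟨hF, hQ⟩ := h u
    set st := (phaseProtocol c κ i tie).wake t (phaseConfig N c κ tie i ω t u)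
    have hsrc : st.inp.src = sampled ω i := by rw [hF.inp]; rfl
    simp only [phaseProtocol, hsrc, hend, if_true, hmod, hQ]
    rw [if_neg (by omega)]
  rw [phaseConfig_succ]
  simp only [hsend]
  refine ⟨?_, ?_⟩
  · have hA := ((h v).1.fresh false).absorbAll
      (msgs := fun u => if N.graph.Adj u v then (frameQueue N c htie i ω β u)[k]? else none)
      (fun u m hm => by
        split_ifs at hm
        exact exists_of_mem_frameQueue htie (List.mem_of_getElem? hm)) (List.finRange n)
    convert hA using 2 with s
    rw [Set.union_assoc]
    congr 1
    ext b
    simp only [Nat.lt_succ_iff_lt_or_eq, or_and_right, exists_or, exists_eq_left, and_or_left,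
      Set.mem_union, Set.mem_ofPred_eq, List.mem_finRange, true_and]
    refine or_congr Iff.rfl (exists_congr fun u => ?_)
    split_ifs with hadj <;> simp [hadj]
  · rw [absorbAll_queue]
    exact (h v).2

theorem withinFrame_wake {β : ℕ} (hβ : β < numFrames n (sampled ω i).card)
    (h : ∀ v, InFrame N c htie i ω β v (phaseConfig N c κ tie i ω
      (bfRounds n c i (sampled ω i).card + β * frameLen n κ) v)) (k : ℕ) (hk : k < frameLen n κ)
    (t : ℕ) (ht : t = bfRounds n c i (sampled ω i).card + β * frameLen n κ + k) (v : Fin n) :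
    WithinFrame N c htie i ω β k v
      ((phaseProtocol c κ i tie).wake t (phaseConfig N c κ tie i ω t v)) := by
  have hend : t < phaseEnd n c κ i (sampled ω i).card := by
    have : (β + 1) * frameLen n κ ≤ numFrames n (sampled ω i).card * frameLen n κ :=
      Nat.mul_le_mul_right _ hβ
    rw [add_mul] at this
    rw [phaseEnd]
    omega
  have hsub : t - bfRounds n c i (sampled ω i).card = β * frameLen n κ + k := by omega
  induction k generalizing t v with
  | zero =>
    rw [add_zero] at ht
    subst ht
    have hsrc : (phaseConfig N c κ tie i ω
      (bfRounds n c i (sampled ω i).card + β * frameLen n κ) v).inp.src = sampled ω i := by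
      rw [(h v).inp]; rfl
    simp only [phaseProtocol, hsrc, hend, hsub, add_zero, Nat.mul_mod_left, and_self,
      Nat.le_add_right, if_true, Nat.mul_div_cancel _ hk]
    exact withinFrame_frameStep htie (h v)
  | succ k ih =>
    obtain ⟨t, rfl⟩ : ∃ t', t = t' + 1 := ⟨t - 1, by omega⟩
    have hw := withinFrame_phaseConfig_succ htie (κ := κ) (k := k) (t := t) (by omega) hβ (by omega)
      (fun v => ih (by omega) t (by omega) v (by omega) (by omega)) v
    have hsrc : (phaseConfig N c κ tie i ω (t + 1) v).inp.src = sampled ω i := by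
      rw [hw.1.inp]; rfl
    have hid : (phaseProtocol c κ i tie).wake (t + 1) (phaseConfig N c κ tie i ω (t + 1) v) =
        phaseConfig N c κ tie i ω (t + 1) v := by
      refine if_neg ?_
      rw [hsrc, hsub, Nat.mul_add_mod_of_lt hk]
      omega
    rw [hid]
    exact hw

/-- The node program carries out the loss-free broadcasts, as long as every frame suffices for its
messages. -/
theorem inFrame_phaseConfig (hd : 0 < depth n c i) (hF : 0 < frameLen n κ)
    (hload : ∀ β < numFrames n (sampled ω i).card, ∀ u, load N c htie i ω β u ≤ frameLen n κ)
    (β : ℕ) (hβ : β ≤ numFrames n (sampled ω i).card) (v : Fin n) :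
    InFrame N c htie i ω β v (phaseConfig N c κ tie i ω
      (bfRounds n c i (sampled ω i).card + β * frameLen n κ) v) := by
  induction β generalizing v with
  | zero =>
    rw [zero_mul, add_zero]
    exact inFrame_zero htie hd v
  | succ β ih =>
    refine inFrame_of_withinFrame htie (hload β hβ) ?_
    have hw := withinFrame_phaseConfig_succ htie (κ := κ) (k := frameLen n κ - 1)
      (by omega) hβ rfl
      (withinFrame_wake htie hβ (fun v => ih (by omega) v) _ (by omega) _ rfl) v
    rw [Nat.sub_add_cancel hF] at hw
    convert hw using 2
    rw [add_mul]
    omega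

theorem startDelay_le (s : Fin n) : startDelay ω i s ≤ (sampled ω i).card * lg n ^ 2 :=
  Nat.lt_succ_iff.1 (ω.2.2 i s _).2

theorem stateAt_end (s : Fin n) :
    stateAt N c htie i ω (numFrames n (sampled ω i).card) s =
      (bcast N c htie i ω s).run (fbRounds n) := by
  have := startDelay_le (ω := ω) (i := i) s
  rw [stateAt, numFrames, min_eq_left (by omega)]

theorem inFrame_after_end (hd : 0 < depth n c i) (hF : 0 < frameLen n κ)
    (hload : ∀ β < numFrames n (sampled ω i).card, ∀ u, load N c htie i ω β u ≤ frameLen n κ)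
    (t : ℕ) (ht : phaseEnd n c κ i (sampled ω i).card ≤ t) (v : Fin n) :
    InFrame N c htie i ω (numFrames n (sampled ω i).card) v (phaseConfig N c κ tie i ω t v) ∧
    (phaseProtocol c κ i tie).send t
      ((phaseProtocol c κ i tie).wake t (phaseConfig N c κ tie i ω t v)) = none := by
  have key : ∀ t, phaseEnd n c κ i (sampled ω i).card ≤ t → ∀ v,
      InFrame N c htie i ω (numFrames n (sampled ω i).card) v (phaseConfig N c κ tie i ω t v) →
      (phaseProtocol c κ i tie).wake t (phaseConfig N c κ tie i ω t v) =
        phaseConfig N c κ tie i ω t v ∧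
      (phaseProtocol c κ i tie).send t (phaseConfig N c κ tie i ω t v) = none := by
    intro t ht v h
    have hsrc : (phaseConfig N c κ tie i ω t v).inp.src = sampled ω i := by rw [h.inp]; rfl
    have hle : bfRounds n c i (sampled ω i).card ≤ phaseEnd n c κ i (sampled ω i).card :=
      Nat.le_add_right _ _
    constructor
    · refine if_neg ?_
      rw [hsrc]
      omega
    · simp only [phaseProtocol, hsrc]
      rw [if_neg (by omega), if_neg (by omega)]
  have hin : ∀ v, InFrame N c htie i ω (numFrames n (sampled ω i).card) v
      (phaseConfig N c κ tie i ω t v) := by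
    induction t, ht using Nat.le_induction with
    | base => exact inFrame_phaseConfig htie hd hF hload _ le_rfl
    | succ t ht ih =>
      intro v
      classical
      rw [phaseConfig_succ]
      have hw : ∀ u, (phaseProtocol c κ i tie).wake t (phaseConfig N c κ tie i ω t u) =
          phaseConfig N c κ tie i ω t u := fun u => (key t ht u (ih u)).1
      have hs : ∀ u, (phaseProtocol c κ i tie).send t (phaseConfig N c κ tie i ω t u) = none :=
        fun u => (key t ht u (ih u)).2
      simp only [hw, hs, ite_self]
      have hA := ((ih v).fresh false).absorbAll (msgs := fun _ => none)
        (fun u m hm => by simp at hm) (List.finRange n)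
      simpa [InFrame] using hA
  refine ⟨hin v, ?_⟩
  rw [(key t ht v (hin v)).1]
  exact (key t ht v (hin v)).2

/-- If no frame is overloaded, then the phase ends as scheduled, with the correct result. -/
theorem phaseTerminates_of_load_le (hn : 0 < n) (hd : 0 < depth n c i) (hF : 0 < frameLen n κ)
    (hload : ∀ β < numFrames n (sampled ω i).card, ∀ u, load N c htie i ω β u ≤ frameLen n κ) :
    PhaseTerminates N c κ tie i ω (phaseEnd n c κ i (sampled ω i).card) := by
  intro t ht v
  obtain ⟨h, hs⟩ := inFrame_after_end htie hd hF hload t ht v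
  refine ⟨hs, fun s _ => ?_⟩
  change min ((phaseConfig N c κ tie i ω t v).inp.known s)
    (min ((phaseConfig N c κ tie i ω t v).dhat s) ((phaseConfig N c κ tie i ω t v).out s)) = _
  rw [h.dhat, h.out_eq, h.inp, stateAt_end, fbRounds, Broadcast.out_eq_target hn, phaseResult]
  refine congrArg₂ min rfl ?_
  have hlayer : (bcast N c htie i ω s).layer (lg n) = sampled ω (i + 1) := by
    change between ω i s (lg n - lg n) = _
    rw [Nat.sub_self, between_zero]
  have htarget : (bcast N c htie i ω s).target (lg n) v =
      ⨅ b ∈ sampled ω (i + 1), (estimate N c i ω s b + N.dist b v) := by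
    rw [Broadcast.target, hlayer]
    refine iInf_congr fun b => iInf_congr fun hb => ?_
    exact congrArg _ (known_of_mem_sampled N i ω hb v)
  rw [htarget]
  by_cases hs : s ∈ sampled ω i
  · simp only [estimate, if_pos hs]
  · simp [estimate, if_neg hs]

end Phase

end CongestAPSP

/-! ### Uniform probabilities on finite types -/

namespace CongestAPSP

open Classical in
/-- The probability of `E` under the uniform distribution on a finite type. -/
noncomputable def prob {α : Type*} [Fintype α] (E : Set α) : ℝ :=
  (Finset.univ.filter (· ∈ E)).card / Fintype.card α

section prob

variable {α β ι : Type*} [Fintype α] [Fintype β] [Fintype ι]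

theorem prob_eq (E : Set α) [DecidablePred (· ∈ E)] :
    prob E = (Finset.univ.filter (· ∈ E)).card / Fintype.card α := by
  rw [prob]
  congr!

theorem prob_mono {E F : Set α} (h : E ⊆ F) : prob E ≤ prob F := by
  unfold prob
  gcongr

theorem prob_nonneg (E : Set α) : 0 ≤ prob E := by unfold prob; positivity

theorem prob_empty : prob (∅ : Set α) = 0 := by simp [prob]

theorem prob_union_le (E F : Set α) : prob (E ∪ F) ≤ prob E + prob F := by
  classical
  rw [prob, prob, prob, ← add_div]
  gcongr
  norm_cast
  refine le_trans (Finset.card_le_card fun x hx => ?_) (Finset.card_union_le _ _)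
  simpa using hx

theorem prob_iUnion_le (E : ι → Set α) {ε : ℝ} (h : ∀ i, prob (E i) ≤ ε) :
    prob (⋃ i, E i) ≤ Fintype.card ι * ε := by
  classical
  calc prob (⋃ i, E i) ≤ ∑ i, prob (E i) := by
        simp only [prob]
        rw [← Finset.sum_div]
        gcongr
        norm_cast
        refine le_trans (Finset.card_le_card fun x hx => ?_) Finset.card_biUnion_le
        simpa using hx
    _ ≤ ∑ _i : ι, ε := Finset.sum_le_sum fun i _ => h i
    _ = _ := by simp

theorem prob_compl [Nonempty α] (E : Set α) : prob Eᶜ = 1 - prob E := by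
  classical
  rw [prob, prob, eq_sub_iff_add_eq, ← add_div, div_eq_one_iff_eq (by simp)]
  norm_cast
  rw [add_comm]
  simpa using Finset.card_filter_add_card_filter_not (s := (Finset.univ : Finset α)) (· ∈ E)

/-- Resampling a component `get ω` of a uniformly distributed `ω` does not change the distribution,
so that the probability of an event may be bounded by conditioning on the rest of `ω`. -/
theorem prob_le_of_resample [Nonempty α] (get : α → β) (set : α → β → α)
    (h1 : ∀ ω x, get (set ω x) = x) (h2 : ∀ ω x y, set (set ω x) y = set ω y)
    (h3 : ∀ ω, set ω (get ω) = ω) {E : Set α} {ε : ℝ}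
    (h : ∀ ω, prob {x | set ω x ∈ E} ≤ ε) : prob E ≤ ε := by
  classical
  have hβ : Nonempty β := ⟨get (Classical.arbitrary α)⟩
  have hcβ : (0 : ℝ) < Fintype.card β := by exact_mod_cast Fintype.card_pos
  have hcα : (0 : ℝ) < Fintype.card α := by exact_mod_cast Fintype.card_pos
  -- Exchanging the component of `ω` with a fresh copy is an involution.
  let e : α × β ≃ α × β :=
    { toFun := fun p => (set p.1 p.2, get p.1)
      invFun := fun p => (set p.1 p.2, get p.1)
      left_inv := fun p => by simp [h1, h2, h3]
      right_inv := fun p => by simp [h1, h2, h3] }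
  have hcount : (Finset.univ.filter (· ∈ E)).card * Fintype.card β =
      ∑ ω : α, (Finset.univ.filter fun x => set ω x ∈ E).card := by
    calc (Finset.univ.filter (· ∈ E)).card * Fintype.card β
        = (Finset.univ.filter fun p : α × β => p.1 ∈ E).card := by
          rw [← Finset.card_univ, ← Finset.card_product]
          congr 1
          ext p
          simp
      _ = (Finset.univ.filter fun p : α × β => (e p).1 ∈ E).card := by
          refine (Finset.card_equiv e fun p => ?_).symm
          simp
      _ = ∑ ω : α, (Finset.univ.filter fun x => set ω x ∈ E).card := by
          simp only [Finset.card_filter]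
          rw [Fintype.sum_prod_type]
          rfl
  rw [prob, div_le_iff₀ hcα, ← mul_le_mul_iff_left₀ hcβ]
  have hcount' : ((Finset.univ.filter (· ∈ E)).card : ℝ) * Fintype.card β =
      ∑ ω : α, ((Finset.univ.filter fun x => set ω x ∈ E).card : ℝ) := by exact_mod_cast hcount
  rw [hcount']
  calc ∑ ω : α, ((Finset.univ.filter fun x => set ω x ∈ E).card : ℝ)
      ≤ ∑ _ω : α, ε * Fintype.card β := Finset.sum_le_sum fun ω _ => by
        have := h ω
        rwa [prob, div_le_iff₀ hcβ] at this
    _ = ε * Fintype.card α * Fintype.card β := by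
        simp
        ring

theorem prob_eval_le [DecidableEq ι] {κ : ι → Type*} [∀ i, Fintype (κ i)] [∀ i, Nonempty (κ i)]
    (i : ι) (A : Set (κ i)) : prob {f : ∀ i, κ i | f i ∈ A} ≤ prob A :=
  prob_le_of_resample (fun f => f i) (fun f x => Function.update f i x) (by simp) (by simp)
    (by simp) (by simp)

open Classical in
/-- The exponential moment, for base `2`, of the number of independent events `E i` that occur. -/
theorem sum_prod_ite_le {κ : ι → Type*} [∀ i, Fintype (κ i)]
    [∀ i, Nonempty (κ i)] (E : ∀ i, Set (κ i)) (p : ι → ℝ) (hp : ∀ i, prob (E i) ≤ p i) :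
    ∑ f : ∀ i, κ i, ∏ i, (if f i ∈ E i then (2 : ℝ) else 1) ≤
      Real.exp (∑ i, p i) * Fintype.card (∀ i, κ i) := by
  have hcκ : ∀ i, (0 : ℝ) < Fintype.card (κ i) := fun i => by exact_mod_cast Fintype.card_pos
  have hsum : ∀ i, ∑ x : κ i, (if x ∈ E i then (2 : ℝ) else 1) =
      Fintype.card (κ i) * (1 + prob (E i)) := fun i => by
    have : ∀ x : κ i, (if x ∈ E i then (2 : ℝ) else 1) = 1 + if x ∈ E i then 1 else 0 :=
      fun x => by split_ifs <;> norm_num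
    simp only [this, Finset.sum_add_distrib, Finset.sum_boole]
    rw [prob_eq, mul_add, mul_div_cancel₀ _ (hcκ i).ne']
    simp
  calc ∑ f : ∀ i, κ i, ∏ i, (if f i ∈ E i then (2 : ℝ) else 1)
      = ∏ i, ∑ x : κ i, (if x ∈ E i then (2 : ℝ) else 1) :=
        (Fintype.prod_sum fun i (x : κ i) => if x ∈ E i then (2 : ℝ) else 1).symm
    _ = ∏ i, (Fintype.card (κ i) * (1 + prob (E i))) := Finset.prod_congr rfl fun i _ => hsum i
    _ ≤ ∏ i, (Fintype.card (κ i) * Real.exp (p i)) := by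
        refine Finset.prod_le_prod (fun i _ => ?_) fun i _ => ?_
        · have := prob_nonneg (E i)
          positivity
        · gcongr
          have := Real.add_one_le_exp (p i)
          linarith [hp i]
    _ = Real.exp (∑ i, p i) * Fintype.card (∀ i, κ i) := by
        rw [Finset.prod_mul_distrib, Real.exp_sum, Fintype.card_pi, mul_comm, Nat.cast_prod]

/-- A Chernoff bound for the number of independent events `E i` that occur. -/
theorem prob_le_card_le [DecidableEq ι] {κ : ι → Type*} [∀ i, Fintype (κ i)]
    [∀ i, Nonempty (κ i)] (E : ∀ i, Set (κ i)) (p : ι → ℝ) (hp : ∀ i, prob (E i) ≤ p i) (k : ℕ)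
    (S : (∀ i, κ i) → Finset ι) (hS : ∀ f, ∀ i ∈ S f, f i ∈ E i) :
    prob {f : ∀ i, κ i | k ≤ (S f).card} ≤ Real.exp (∑ i, p i) / 2 ^ k := by
  classical
  have hc : (0 : ℝ) < Fintype.card (∀ i, κ i) := by exact_mod_cast Fintype.card_pos
  have hmoment := sum_prod_ite_le E p hp
  obtain ⟨A, hA, hprob⟩ : ∃ A : Finset (∀ i, κ i), (∀ f ∈ A, k ≤ (S f).card) ∧
      prob {f : ∀ i, κ i | k ≤ (S f).card} = A.card / Fintype.card (∀ i, κ i) :=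
    ⟨_, fun f hf => by simpa using hf, rfl⟩
  rw [hprob, div_le_div_iff₀ hc (by positivity)]
  have h1 : (A.card : ℝ) * 2 ^ k ≤ ∑ f ∈ A, ∏ i, (if f i ∈ E i then (2 : ℝ) else 1) := by
    rw [← nsmul_eq_mul]
    refine Finset.card_nsmul_le_sum _ _ _ fun f hf => ?_
    rw [Finset.prod_ite, Finset.prod_const, Finset.prod_const_one, mul_one]
    refine pow_le_pow_right₀ one_le_two ?_
    exact (hA f hf).trans (Finset.card_le_card fun i hi =>
      Finset.mem_filter.2 ⟨Finset.mem_univ i, hS f i hi⟩)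
  refine h1.trans (le_trans ?_ (hmoment.trans_eq ?_))
  · refine le_trans (Finset.sum_le_univ_sum_of_nonneg fun f => Finset.prod_nonneg fun i _ => ?_)
      (le_of_eq ?_)
    · split_ifs <;> norm_num
    · congr!
  · congr!

/-- Prescribed coins in `T` show up with probability `2 ^ (-|T|)`. -/
theorem prob_coins_le [DecidableEq ι] (T : Finset ι) (a : Bool) :
    prob {x : ι → Bool | ∀ t ∈ T, x t = a} ≤ 1 / 2 ^ T.card := by
  classical
  have hc : (0 : ℝ) < Fintype.card (ι → Bool) := by exact_mod_cast Fintype.card_pos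
  rw [prob_eq, div_le_div_iff₀ hc (by positivity), one_mul]
  norm_cast
  have h : (Finset.univ.filter (· ∈ {x : ι → Bool | ∀ t ∈ T, x t = a})) =
      Fintype.piFinset fun i => if i ∈ T then {a} else Finset.univ := by
    ext x
    simp only [Finset.mem_filter, Finset.mem_univ, true_and, Fintype.mem_piFinset]
    refine forall_congr' fun i => ?_
    split_ifs with hi <;> simp [hi]
  rw [h, Fintype.card_piFinset]
  simp only [apply_ite Finset.card, Finset.card_singleton, Finset.card_univ, Fintype.card_bool]
  rw [Finset.prod_ite, Finset.prod_const_one, one_mul, Finset.prod_const, ← pow_add]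
  simp only [Fintype.card_pi, Fintype.card_bool, Finset.prod_const]
  refine Nat.pow_le_pow_right (by norm_num) (le_of_eq ?_)
  have := Finset.card_filter_add_card_filter_not (s := (Finset.univ : Finset ι)) (· ∈ T)
  rw [add_comm]
  simpa using this

end prob

theorem coinMeasure_real {n : ℕ} (S : Set (Coins n)) : (coinMeasure n).real S = prob S := by
  classical
  have hS : MeasurableSet S := S.toFinite.measurableSet
  rw [MeasureTheory.measureReal_def, coinMeasure, PMF.toMeasure_uniformOfFintype_apply S hS,
    ENNReal.toReal_div, prob]
  simp only [ENNReal.toReal_natCast]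
  rw [Fintype.card_subtype]

/-- A set of `z` elements of `B` of least value under `f`. -/
theorem exists_lowest {α γ : Type*} [DecidableEq α] [LinearOrder γ] (f : α → γ) (B : Finset α)
    (z : ℕ) (hz : z ≤ B.card) :
    ∃ T ⊆ B, T.card = z ∧ ∀ t ∈ T, ∀ b ∈ B, b ∉ T → f t ≤ f b := by
  induction z with
  | zero => exact ⟨∅, by simp⟩
  | succ z ih =>
    obtain ⟨T, hT, hcard, hle⟩ := ih (by omega)
    have hne : (B \ T).Nonempty := by
      rw [← Finset.card_pos, Finset.card_sdiff_of_subset hT]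
      omega
    obtain ⟨b₀, hb₀, hmin⟩ := Finset.exists_min_image (B \ T) f hne
    rw [Finset.mem_sdiff] at hb₀
    refine ⟨insert b₀ T, Finset.insert_subset hb₀.1 hT, ?_, ?_⟩
    · rw [Finset.card_insert_of_notMem hb₀.2, hcard]
    · intro t ht b hb hbT
      rw [Finset.mem_insert, not_or] at hbT
      rcases Finset.mem_insert.1 ht with rfl | ht
      · exact hmin b (Finset.mem_sdiff.2 ⟨hb, hbT.2⟩)
      · exact hle t ht b hb hbT.2

/-- If every element of `B` is selected with probability `1 / 2`, then at least `z` elements are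
better than all selected ones with probability at most `2 ^ (-z)`: this requires that none of the
`z` best elements is selected. -/
theorem prob_better_le {ι γ : Type*} [Fintype ι] [DecidableEq ι] [CompleteLinearOrder γ]
    (f : ι → γ) (B : Finset ι) (z : ℕ) (S : (ι → Bool) → Finset ι)
    (hS : ∀ x, S x ⊆ B) (hlt : ∀ x, ∀ b ∈ S x, ∀ b' ∈ B, x b' = true → f b < f b') :
    prob {x : ι → Bool | z ≤ (S x).card} ≤ 1 / 2 ^ z := by
  by_cases hz : z ≤ B.card
  · obtain ⟨T, hT, hcard, hle⟩ := exists_lowest f B z hz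
    rw [← hcard]
    refine (prob_mono fun x hx t ht => ?_).trans (prob_coins_le T false)
    by_contra hxt
    have hxt : x t = true := by simpa using hxt
    have hsub : S x ⊆ T.erase t := fun b hb => by
      have hbt := hlt x b hb t (hT ht) hxt
      refine Finset.mem_erase.2 ⟨fun h => (h ▸ hbt).false, ?_⟩
      by_contra hbT
      exact absurd hbt (not_lt.2 (hle t ht b (hS x hb) hbT))
    have := Finset.card_le_card hsub
    rw [Finset.card_erase_of_mem ht] at this
    have hpos := Finset.card_pos.2 ⟨t, ht⟩
    have hx : T.card ≤ (S x).card := hx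
    omega
  · have : {x : ι → Bool | z ≤ (S x).card} = ∅ := by
      refine Set.eq_empty_of_forall_notMem fun x (hx : z ≤ (S x).card) => ?_
      exact hz (hx.trans (Finset.card_le_card (hS x)))
    rw [this, prob_empty]
    positivity

end CongestAPSP

/-! ### The random choices of the algorithm -/

namespace CongestAPSP

variable {n : ℕ}

theorem exp_natCast_le_four_pow (Q : ℕ) : Real.exp Q ≤ 4 ^ Q := by
  rw [← mul_one (Q : ℝ), Real.exp_nat_mul]
  have := Real.exp_one_lt_d9
  exact pow_le_pow_left₀ (Real.exp_pos 1).le (by linarith) Q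

theorem card_filter_lt_lg {i : ℕ} (hi : i ≤ lg n) :
    (Finset.univ.filter fun l : Fin (lg n) => l.1 < i).card = i := by
  rw [Fin.card_filter_val_lt]
  exact min_eq_right hi

theorem le_two_pow_lg (n : ℕ) : n ≤ 2 ^ lg n := Nat.le_pow_clog one_lt_two n

theorem one_le_lg (hn : 2 ≤ n) : 1 ≤ lg n := Nat.clog_pos one_lt_two hn

theorem two_pow_lg_le (hn : 2 ≤ n) : 2 ^ lg n ≤ 2 * n := by
  have h := Nat.pow_pred_clog_lt_self one_lt_two hn
  have h1 := one_le_lg hn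
  change 2 ^ (lg n - 1) < n at h
  rw [← Nat.sub_add_cancel h1, pow_succ]
  omega

theorem mem_sampled {ω : Coins n} {i : Fin (lg n + 1)} {v : Fin n} :
    v ∈ sampled ω i ↔ ∀ l : Fin (lg n), l.1 < i.1 → ω.1 v i l = true := by
  simp only [sampled, Finset.mem_filter, Finset.mem_univ, true_and]
  exact ⟨fun ⟨_, h⟩ => h, fun h => ⟨i.2, h⟩⟩

/-- The set `S_i` has `O(log n) · n / 2 ^ i` elements with high probability. -/
theorem prob_le_card_sampled_le (hn : 2 ≤ n) (i : Fin (lg n + 1)) (g : ℕ) :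
    prob {ω : Coins n | (g + 2) * lg n * (n / 2 ^ i.1 + 1) ≤ (sampled ω i).card} ≤
      1 / (2 ^ lg n) ^ g := by
  classical
  set Q := n / 2 ^ i.1 + 1 with hQ
  set k := (g + 2) * lg n * Q with hk
  have hi : i.1 ≤ lg n := Nat.lt_succ_iff.1 i.2
  have hprob : prob {y : Fin (lg n + 1) → Fin (lg n) → Bool | ∀ l : Fin (lg n), l.1 < i.1 →
      y i l = true} ≤ 1 / 2 ^ i.1 := by
    have h := (prob_eval_le (κ := fun _ : Fin (lg n + 1) => Fin (lg n) → Bool) i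
      {x | ∀ t ∈ Finset.univ.filter fun l : Fin (lg n) => l.1 < i.1, x t = true}).trans
      (prob_coins_le _ true)
    rw [card_filter_lt_lg hi] at h
    simpa using h
  have hexp : Real.exp (∑ _v : Fin n, 1 / 2 ^ i.1) / 2 ^ k ≤ 1 / (2 ^ lg n) ^ g := by
    have hsum : ∑ _v : Fin n, (1 : ℝ) / 2 ^ i.1 ≤ Q := by
      simp only [Finset.sum_const, Finset.card_univ, Fintype.card_fin, nsmul_eq_mul, mul_one_div]
      rw [div_le_iff₀ (by positivity)]
      have := (Nat.lt_mul_div_succ n (Nat.two_pow_pos i.1)).le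
      rw [mul_comm] at this
      exact_mod_cast this
    rw [div_le_div_iff₀ (by positivity) (by positivity), one_mul]
    calc Real.exp (∑ _v : Fin n, 1 / 2 ^ i.1) * (2 ^ lg n) ^ g
        ≤ 4 ^ Q * (2 ^ lg n) ^ g := by
          gcongr
          exact (Real.exp_le_exp.2 hsum).trans (exp_natCast_le_four_pow Q)
      _ = 2 ^ (2 * Q + lg n * g) := by
          rw [pow_add (2 : ℝ) (2 * Q), pow_mul (2 : ℝ) 2 Q, pow_mul (2 : ℝ) (lg n) g]
          norm_num
      _ ≤ 2 ^ k := by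
          refine pow_le_pow_right₀ one_le_two ?_
          rw [hk, show (g + 2) * lg n * Q = 2 * (lg n * Q) + lg n * g * Q by ring]
          exact add_le_add (Nat.mul_le_mul_left _ (Nat.le_mul_of_pos_left _ (one_le_lg hn)))
            (Nat.le_mul_of_pos_right _ (Nat.le_add_left 1 _))
  refine prob_le_of_resample (fun ω => ω.1) (fun ω x => (x, ω.2)) (fun _ _ => rfl)
    (fun _ _ _ => rfl) (fun _ => rfl) fun ω => ?_
  refine (prob_le_card_le (κ := fun _ : Fin n => Fin (lg n + 1) → Fin (lg n) → Bool)
    (fun _ => {y | ∀ l : Fin (lg n), l.1 < i.1 → y i l = true})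
    (fun _ => 1 / 2 ^ i.1) (fun _ => hprob) k (fun x => sampled (n := n) (x, ω.2) i)
    fun x v hv => ?_).trans hexp
  exact mem_sampled.1 hv

/-- Resampling the filter coins of the broadcast from `s` in phase `i`. -/
def setFilter (i : Fin (lg n + 1)) (s : Fin n) (ω : Coins n) (x : Fin n → Fin (lg n) → Bool) :
    Coins n :=
  (ω.1, Function.update ω.2.1 i (Function.update (ω.2.1 i) s x), ω.2.2)

theorem setFilter_apply (i : Fin (lg n + 1)) (s : Fin n) (ω : Coins n)
    (x : Fin n → Fin (lg n) → Bool) : (setFilter i s ω x).2.1 i s = x := by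
  simp [setFilter]

theorem setFilter_setFilter (i : Fin (lg n + 1)) (s : Fin n) (ω : Coins n)
    (x y : Fin n → Fin (lg n) → Bool) :
    setFilter i s (setFilter i s ω x) y = setFilter i s ω y := by
  simp [setFilter]

theorem setFilter_self (i : Fin (lg n + 1)) (s : Fin n) (ω : Coins n) :
    setFilter i s ω (ω.2.1 i s) = ω := by
  simp [setFilter]

theorem mem_between {i : Fin (lg n + 1)} {s b : Fin n} {ω : Coins n} {j : ℕ} :
    b ∈ between ω i s j ↔
      b ∈ sampled ω (i + 1) ∧ ∀ l : Fin (lg n), l.1 < j → ω.2.1 i s b l = true := by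
  simp [between]

/-- The smallest set `B_{log n}` has `O(log n)` elements with high probability. -/
theorem prob_le_card_between_le (i : Fin (lg n + 1)) (s : Fin n) (k : ℕ) :
    prob {ω : Coins n | k ≤ (between ω i s (lg n)).card} ≤ 4 / 2 ^ k := by
  classical
  have hprob : prob {y : Fin (lg n) → Bool | ∀ l : Fin (lg n), y l = true} ≤ 1 / 2 ^ lg n := by
    simpa using prob_coins_le (Finset.univ : Finset (Fin (lg n))) true
  refine prob_le_of_resample (fun ω => ω.2.1 i s) (setFilter i s) (setFilter_apply i s)
    (setFilter_setFilter i s) (setFilter_self i s) fun ω => ?_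
  refine (prob_le_card_le (κ := fun _ : Fin n => Fin (lg n) → Bool)
    (fun _ => {y | ∀ l : Fin (lg n), y l = true})
    (fun _ => 1 / 2 ^ lg n) (fun _ => hprob) k (fun x => between (setFilter i s ω x) i s (lg n))
    fun x v hv l => ?_).trans ?_
  · rw [← (mem_between.1 hv).2 l l.2, setFilter_apply]
  · gcongr
    have hsum : ∑ _v : Fin n, (1 : ℝ) / 2 ^ lg n ≤ (1 : ℕ) := by
      simp only [Finset.sum_const, Finset.card_univ, Fintype.card_fin, nsmul_eq_mul, mul_one_div]
      rw [div_le_iff₀ (by positivity)]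
      have := le_two_pow_lg n
      rw [Nat.cast_one, one_mul]
      exact_mod_cast this
    exact (Real.exp_le_exp.2 hsum).trans ((exp_natCast_le_four_pow 1).trans (by norm_num))

section Phase

variable (N : Network n) (c : ℕ) {tie : Fin n → Fin n → Finset (Fin n) → Fin n}
  (htie : ∀ v s A, A.Nonempty → tie v s A ∈ A) (i : Fin (lg n + 1))

/-- With high probability, few nodes of `B_j` beat all nodes of `B_{j+1}`, where `k + 1` is the
number of the iteration in which the nodes of `B_j` start. -/
theorem prob_le_card_below_le (s v : Fin n) (k : ℕ) (hk : k < lg n) (z : ℕ) :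
    prob {ω : Coins n | z ≤ ((bcast N c htie i ω s).below (k + 1) v
      ((bcast N c htie i ω s).target k v)).card} ≤ 1 / 2 ^ z := by
  classical
  set j : Fin (lg n) := ⟨lg n - (k + 1), by omega⟩ with hj
  have hjk : lg n - k = j.1 + 1 := by simp only [hj]; omega
  set flip : Coins n → (Fin n → Bool) → Coins n := fun ω x =>
    setFilter i s ω fun b => Function.update (ω.2.1 i s b) j (x b) with hflip
  have hcoin : ∀ ω x b l, (flip ω x).2.1 i s b l =
      Function.update (ω.2.1 i s b) j (x b) l := fun ω x b l => by
    simp only [hflip]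
    rw [setFilter_apply]
  refine prob_le_of_resample (fun ω b => ω.2.1 i s b j) flip (fun ω x => ?_) (fun ω x y => ?_)
    (fun ω => ?_) fun ω => ?_
  · funext b
    simp [hcoin]
  · simp only [hflip]
    rw [setFilter_setFilter, setFilter_apply]
    simp
  · simp only [hflip, Function.update_eq_self]
    exact setFilter_self i s ω
  -- The values and the set `B_j` do not depend on the coins that are resampled.
  have hval : ∀ x b, (bcast N c htie i (flip ω x) s).val b v =
      (bcast N c htie i ω s).val b v := fun x b => rfl
  have hB : ∀ x, between (flip ω x) i s j = between ω i s j := fun x => by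
    ext b
    rw [mem_between, mem_between]
    refine and_congr Iff.rfl (forall_congr' fun l => imp_congr_right fun hl => ?_)
    rw [hcoin, Function.update_of_ne (Fin.ne_of_lt hl)]
  refine prob_better_le (fun b => (bcast N c htie i ω s).val b v) (between ω i s j) z
    (fun x => (bcast N c htie i (flip ω x) s).below (k + 1) v
      ((bcast N c htie i (flip ω x) s).target k v)) (fun x b hb => ?_) fun x b hb b' hb' hx => ?_
  · rw [← hB x]
    exact (Finset.mem_filter.1 hb).1
  · refine (Finset.mem_filter.1 hb).2.trans_le (iInf₂_le b' ?_)
    change b' ∈ between (flip ω x) i s (lg n - k)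
    rw [← hB x] at hb'
    rw [mem_between] at hb' ⊢
    refine ⟨hb'.1, fun l hl => ?_⟩
    rw [hjk] at hl
    rcases Nat.lt_succ_iff_lt_or_eq.1 hl with hl | hl
    · exact hb'.2 l hl
    · obtain rfl : l = j := Fin.ext hl
      rw [hcoin, Function.update_self]
      exact hx

variable {N c i}

theorem card_sendRounds_bcast_le (hn : 2 ≤ n) {ω : Coins n} (s v : Fin n) (z : ℕ)
    (h0 : (between ω i s (lg n)).card ≤ z)
    (h1 : ∀ k < lg n, ((bcast N c htie i ω s).below (k + 1) v
      ((bcast N c htie i ω s).target k v)).card ≤ z) :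
    ((bcast N c htie i ω s).sendRounds v (fbRounds n)).card ≤ (lg n + 1) * (z + 2) := by
  refine Broadcast.card_sendRounds_le hn v _ z fun k hk => ?_
  cases k with
  | zero => exact (Finset.card_le_card (Finset.filter_subset _ _)).trans h0
  | succ k => exact h1 k (by omega)

theorem Broadcast.heard_eq_empty {F : Broadcast n} (h : ∀ b, F.est b = ⊤) (ρ : ℕ) (v : Fin n) :
    (F.run ρ).heard v = ∅ := by
  induction ρ generalizing v with
  | zero => rfl
  | succ ρ ih =>
    have hs : ∀ u, F.sent ρ (F.run ρ) u = none := fun u => if_neg (by simp [Active, h, ih])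
    simp [run, step, ih, hs]

theorem Broadcast.sent_eq_none {F : Broadcast n} (h : ∀ b, F.est b = ⊤) (ρ : ℕ) (v : Fin n) :
    F.sent ρ (F.run ρ) v = none :=
  if_neg (by simp [Active, h, heard_eq_empty h])

/-- With a uniform start delay, a broadcast sends a message in a given frame with probability
proportional to the number of its messages. -/
theorem prob_sent_le (F : Broadcast n) (D β R : ℕ) (v : Fin n) :
    prob {δ : Fin (D + 1) | (δ.1 ≤ β ∧ β < δ.1 + R) ∧
      (F.sent (β - δ.1) (F.run (β - δ.1)) v).isSome = true} ≤
        (F.sendRounds v R).card / (D + 1 : ℕ) := by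
  classical
  rw [prob_eq, Fintype.card_fin]
  gcongr
  refine Finset.card_le_card_of_injOn (fun δ => β - δ.1) (fun δ hδ => ?_) ?_
  · have hδ := (Finset.mem_filter.1 hδ).2
    refine Finset.mem_coe.2 (Finset.mem_filter.2 ⟨Finset.mem_range.2 ?_, ?_⟩)
    · have := hδ.1
      change β - δ.1 < R
      omega
    · exact Option.isSome_iff_ne_none.1 hδ.2
  · intro δ hδ δ' hδ' heq
    have h1 := (Finset.mem_filter.1 hδ).2.1
    have h2 := (Finset.mem_filter.1 hδ').2.1
    simp only at heq
    exact Fin.ext (by omega)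

/-- Random start delays spread the messages: a frame is overloaded with small probability. -/
theorem prob_le_load_le (A : ℕ) (v : Fin n) (β k : ℕ) :
    prob {ω : Coins n | (∀ s, ((bcast N c htie i ω s).sendRounds v (fbRounds n)).card ≤
        A * lg n ^ 2) ∧ k ≤ load N c htie i ω β v} ≤ 4 ^ A / 2 ^ k := by
  classical
  refine prob_le_of_resample (fun ω => ω.2.2 i)
    (fun ω x => (ω.1, ω.2.1, Function.update ω.2.2 i x)) (fun _ _ => by simp)
    (fun _ _ _ => by simp) (fun _ => by simp) fun ω => ?_
  by_cases hgood : ∀ s, ((bcast N c htie i ω s).sendRounds v (fbRounds n)).card ≤ A * lg n ^ 2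
  swap
  · refine (le_of_eq ?_).trans (by positivity : (0 : ℝ) ≤ 4 ^ A / 2 ^ k)
    convert prob_empty (α := Fin n → (m : Fin (n + 1)) → Fin (m.1 * lg n ^ 2 + 1))
    exact Set.eq_empty_of_forall_notMem fun x hx => hgood hx.1
  set m : Fin (n + 1) := ⟨(sampled ω i).card,
    Nat.lt_succ_of_le ((Finset.card_le_univ _).trans_eq (Fintype.card_fin n))⟩ with hm
  set E : Fin n → Set ((m : Fin (n + 1)) → Fin (m.1 * lg n ^ 2 + 1)) := fun s =>
    {y | ((y m : ℕ) ≤ β ∧ β < y m + fbRounds n) ∧ ((bcast N c htie i ω s).sent (β - y m)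
      ((bcast N c htie i ω s).run (β - y m)) v).isSome = true} with hE
  set p : Fin n → ℝ := fun s =>
    if s ∈ sampled ω i then A * lg n ^ 2 / (m.1 * lg n ^ 2 + 1) else 0 with hp
  have hEp : ∀ s, prob (E s) ≤ p s := by
    intro s
    by_cases hs : s ∈ sampled ω i
    · simp only [hp, if_pos hs]
      refine (prob_eval_le (κ := fun m : Fin (n + 1) => Fin (m.1 * lg n ^ 2 + 1)) m
        {δ | (δ.1 ≤ β ∧ β < δ.1 + fbRounds n) ∧ ((bcast N c htie i ω s).sent (β - δ.1)
          ((bcast N c htie i ω s).run (β - δ.1)) v).isSome = true}).trans ?_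
      refine (prob_sent_le _ _ _ _ _).trans ?_
      push_cast
      gcongr
      exact_mod_cast hgood s
    · -- In the broadcast from a node that is not a source, nobody ever sends.
      simp only [hp, if_neg hs]
      refine le_of_eq ?_
      rw [← prob_empty (α := (m : Fin (n + 1)) → Fin (m.1 * lg n ^ 2 + 1))]
      congr 1
      refine Set.eq_empty_of_forall_notMem fun y hy => ?_
      have := hy.2
      rw [Broadcast.sent_eq_none fun b => if_neg hs] at this
      simp at this
  refine (prob_mono fun x hx => hx.2).trans ((prob_le_card_le E p hEp k
    (fun x => Finset.univ.filter fun s => (sentInFrame N c htie i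
      (ω.1, ω.2.1, Function.update ω.2.2 i x) β s v).isSome = true) ?_).trans ?_)
  · intro x s hs
    have hs := (Finset.mem_filter.1 hs).2
    have hdelay : startDelay (n := n) (ω.1, ω.2.1, Function.update ω.2.2 i x) i s = x s m := by
      simp only [startDelay, Function.update_self]
      rfl
    rw [sentInFrame, hdelay] at hs
    split_ifs at hs with h
    · exact ⟨h, hs⟩
    · simp at hs
  · gcongr
    refine (Real.exp_le_exp.2 ?_).trans (exp_natCast_le_four_pow A)
    simp only [hp]
    rw [Finset.sum_ite_mem, Finset.univ_inter, Finset.sum_const, nsmul_eq_mul, mul_div_assoc',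
      div_le_iff₀ (by positivity)]
    simp only [hm]
    nlinarith [(Nat.cast_nonneg A : (0 : ℝ) ≤ A)]

end Phase

end CongestAPSP

/-! ### Typical random choices and the running time -/

namespace CongestAPSP

variable {n : ℕ}

theorem numFrames_le (hn : 2 ≤ n) : numFrames n n ≤ (2 ^ lg n) ^ 4 := by
  have h1 : lg n + 1 ≤ 2 ^ lg n := Nat.lt_two_pow_self
  have h2 := le_two_pow_lg n
  generalize 2 ^ lg n = L at h1 h2 ⊢
  calc numFrames n n ≤ L * L ^ 2 + L * L := by
        rw [numFrames, fbRounds]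
        gcongr
        omega
    _ ≤ L * L ^ 2 + L * L * L := by
        gcongr
        exact Nat.le_mul_of_pos_right _ (by omega)
    _ = 2 * L ^ 3 := by ring
    _ ≤ L * L ^ 3 := by
        gcongr
        omega
    _ = L ^ 4 := by ring

section Phase

variable (N : Network n) (c κ g : ℕ) {tie : Fin n → Fin n → Finset (Fin n) → Fin n}
  (htie : ∀ v s A, A.Nonempty → tie v s A ∈ A)

/-- The random choices are typical: no sampled set is much larger than expected, and no frame has
more messages than fit into it. -/
structure Typical (ω : Coins n) : Prop where
  card_sampled : ∀ i : Fin (lg n + 1),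
    (sampled ω i).card < (g + 2) * lg n * (n / 2 ^ i.1 + 1)
  load_le : ∀ (i : Fin (lg n + 1)) (v : Fin n) (β : Fin (numFrames n n)),
    load N c htie i ω β v ≤ frameLen n κ

/-- With suitable constants, the random choices are typical with high probability.  With
`L = 2 ^ lg n`, there are at most `L ^ 6` exceptional events of each kind, and the constants `a` and
`κ` make each of them rare enough for a union bound. -/
theorem prob_not_typical_le (hn : 2 ≤ n) (γ : ℕ) :
    prob {ω | ¬ Typical N c (4 * (γ + 8) + γ + 8) (γ + 3) htie ω} ≤ 1 / (n : ℝ) ^ γ := by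
  obtain ⟨a, ha⟩ : ∃ a, a = γ + 6 := ⟨_, rfl⟩
  obtain ⟨A, hA⟩ : ∃ A, A = 2 * (a + 2) := ⟨_, rfl⟩
  obtain ⟨κ, hκ⟩ : ∃ κ, κ = 2 * A + γ + 8 := ⟨_, rfl⟩
  rw [show 4 * (γ + 8) + γ + 8 = κ by omega]
  have hlg := one_le_lg hn
  obtain ⟨L, hL⟩ : ∃ L : ℝ, L = 2 ^ lg n := ⟨_, rfl⟩
  have hL2 : (2 : ℝ) ≤ L := by
    rw [hL]; exact le_self_pow₀ one_le_two (by omega)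
  have hlgL : (lg n : ℝ) + 1 ≤ L := by
    have : lg n + 1 ≤ 2 ^ lg n := Nat.lt_two_pow_self
    rw [hL]
    exact_mod_cast this
  have hnL : (n : ℝ) ≤ L := by
    rw [hL]; exact_mod_cast le_two_pow_lg n
  have hML : (numFrames n n : ℝ) ≤ L ^ 4 := by
    rw [hL]; exact_mod_cast numFrames_le hn
  have hpow : ∀ k : ℕ, (2 : ℝ) ^ (k * lg n) = L ^ k := fun k => by rw [hL, ← pow_mul, mul_comm]
  -- A sampled set is too large, a smallest set `B_{log n}` is too large, too many nodes of some
  -- `B_j` beat all of `B_{j+1}`, or a frame is overloaded although no broadcast sends much.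
  set E₁ : Fin (lg n + 1) → Set (Coins n) := fun i =>
    {ω | (γ + 3 + 2) * lg n * (n / 2 ^ i.1 + 1) ≤ (sampled ω i).card} with hE₁
  set E₂ : Fin (lg n + 1) × Fin n → Set (Coins n) := fun q =>
    {ω | a * lg n ≤ (between ω q.1 q.2 (lg n)).card} with hE₂
  set E₃ : Fin (lg n + 1) × Fin n × Fin n × Fin (lg n) → Set (Coins n) := fun q =>
    {ω | a * lg n ≤ ((bcast N c htie q.1 ω q.2.1).below (q.2.2.2.1 + 1) q.2.2.1
      ((bcast N c htie q.1 ω q.2.1).target q.2.2.2.1 q.2.2.1)).card} with hE₃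
  set E₄ : Fin (lg n + 1) × Fin n × Fin (numFrames n n) → Set (Coins n) := fun q =>
    {ω | (∀ s, ((bcast N c htie q.1 ω s).sendRounds q.2.1 (fbRounds n)).card ≤ A * lg n ^ 2) ∧
      κ * lg n ≤ load N c htie q.1 ω q.2.2 q.2.1} with hE₄
  have hsub : {ω | ¬ Typical N c κ (γ + 3) htie ω} ⊆
      ((⋃ q, E₁ q) ∪ ⋃ q, E₂ q) ∪ ((⋃ q, E₃ q) ∪ ⋃ q, E₄ q) := by
    intro ω hω
    by_contra hnot
    simp only [Set.mem_union, Set.mem_iUnion, not_or, not_exists] at hnot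
    obtain ⟨⟨h1, h2⟩, h3, h4⟩ := hnot
    refine hω ⟨fun i => not_le.1 (h1 i), fun i v β => ?_⟩
    refine (not_le.1 fun hle => h4 (i, v, β) ⟨fun s => ?_, hle⟩).le
    refine (card_sendRounds_bcast_le htie hn s v (a * lg n) (not_le.1 (h2 (i, s))).le
      fun k hk => (not_le.1 (h3 (i, s, v, ⟨k, hk⟩))).le).trans ?_
    rw [hA]
    nlinarith [Nat.mul_le_mul hlg hlg, Nat.mul_le_mul hlg (le_refl a),
      Nat.mul_le_mul hlg (le_refl (a * lg n))]
  have hγ : (0 : ℝ) < L ^ (γ + 2) := by positivity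
  have b1 : prob (⋃ q, E₁ q) ≤ 1 / L ^ (γ + 2) := by
    refine (prob_iUnion_le E₁ fun i => prob_le_card_sampled_le hn i (γ + 3)).trans ?_
    rw [Fintype.card_fin, mul_one_div, div_le_div_iff₀ (by positivity) hγ, one_mul, ← hL]
    push_cast
    calc ((lg n : ℝ) + 1) * L ^ (γ + 2) ≤ L * L ^ (γ + 2) := by gcongr
      _ = L ^ (γ + 3) := by ring
  have b2 : prob (⋃ q, E₂ q) ≤ 1 / L ^ (γ + 2) := by
    refine (prob_iUnion_le E₂ fun q => prob_le_card_between_le q.1 q.2 (a * lg n)).trans ?_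
    rw [mul_div_assoc', div_le_div_iff₀ (by positivity) hγ, one_mul, hpow, Fintype.card_prod,
      Fintype.card_fin, Fintype.card_fin]
    push_cast
    calc ((lg n : ℝ) + 1) * n * 4 * L ^ (γ + 2) ≤ L * L * L ^ 2 * L ^ (γ + 2) := by
          gcongr
          nlinarith
      _ = L ^ a := by rw [ha]; ring
  have b3 : prob (⋃ q, E₃ q) ≤ 1 / L ^ (γ + 2) := by
    refine (prob_iUnion_le E₃ fun q =>
      prob_le_card_below_le N c htie q.1 q.2.1 q.2.2.1 q.2.2.2.1 q.2.2.2.2 (a * lg n)).trans ?_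
    rw [mul_one_div, div_le_div_iff₀ (by positivity) hγ, one_mul, hpow]
    simp only [Fintype.card_prod, Fintype.card_fin]
    push_cast
    calc ((lg n : ℝ) + 1) * (n * (n * lg n)) * L ^ (γ + 2)
        ≤ L * (L * (L * L)) * L ^ (γ + 2) := by
          gcongr
          linarith
      _ = L ^ a := by rw [ha]; ring
  have b4 : prob (⋃ q, E₄ q) ≤ 1 / L ^ (γ + 2) := by
    refine (prob_iUnion_le E₄ fun q =>
      prob_le_load_le htie A q.2.1 q.2.2 (κ * lg n)).trans ?_
    rw [mul_div_assoc', div_le_div_iff₀ (by positivity) hγ, one_mul, hpow]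
    simp only [Fintype.card_prod, Fintype.card_fin]
    push_cast
    have h4 : (4 : ℝ) ^ A ≤ L ^ (2 * A) := by
      rw [pow_mul]
      exact pow_le_pow_left₀ (by norm_num) (by nlinarith) A
    calc ((lg n : ℝ) + 1) * (n * numFrames n n) * 4 ^ A * L ^ (γ + 2)
        ≤ L * (L * L ^ 4) * L ^ (2 * A) * L ^ (γ + 2) := by gcongr
      _ = L ^ κ := by rw [hκ]; ring
  refine (prob_mono hsub).trans ((prob_union_le _ _).trans ((add_le_add (prob_union_le _ _)
    (prob_union_le _ _)).trans ?_))
  have hsum : 4 * (1 / L ^ (γ + 2)) ≤ 1 / (n : ℝ) ^ γ := by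
    have hn0 : (0 : ℝ) < n := by exact_mod_cast (by omega : 0 < n)
    rw [mul_one_div, div_le_div_iff₀ hγ (by positivity), one_mul, pow_add, mul_comm]
    gcongr
    nlinarith
  linarith

variable {N c κ g htie} {ω : Coins n}

theorem Typical.phaseTerminates (h : Typical N c κ g htie ω) (hn : 2 ≤ n) (hc : 1 ≤ c)
    (hκ : 1 ≤ κ) (i : Fin (lg n + 1)) :
    PhaseTerminates N c κ tie i ω (phaseEnd n c κ i (sampled ω i).card) := by
  have hlg := one_le_lg hn
  refine phaseTerminates_of_load_le htie (by omega) ?_ ?_ fun β hβ u => ?_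
  · rw [depth]; positivity
  · rw [frameLen]; positivity
  · refine h.load_le i u ⟨β, hβ.trans_le ?_⟩
    rw [numFrames, numFrames]
    gcongr
    exact (Finset.card_le_univ _).trans_eq (Fintype.card_fin n)

theorem Typical.card_sampled_mul_le (h : Typical N c κ g htie ω) (hn : 2 ≤ n)
    (i : Fin (lg n + 1)) : (sampled ω i).card * 2 ^ i.1 ≤ 3 * (g + 2) * lg n * n := by
  have h1 : 2 ^ i.1 ≤ 2 * n :=
    (Nat.pow_le_pow_right two_pos (Nat.lt_succ_iff.1 i.2)).trans (two_pow_lg_le hn)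
  have h2 : n / 2 ^ i.1 * 2 ^ i.1 ≤ n := Nat.div_mul_le_self n _
  calc (sampled ω i).card * 2 ^ i.1
      ≤ (g + 2) * lg n * (n / 2 ^ i.1 + 1) * 2 ^ i.1 := by gcongr; exact (h.card_sampled i).le
    _ = (g + 2) * lg n * (n / 2 ^ i.1 * 2 ^ i.1 + 2 ^ i.1) := by ring
    _ ≤ (g + 2) * lg n * (n + 2 * n) := by gcongr
    _ = _ := by ring

theorem Typical.phaseEnd_le (h : Typical N c κ g htie ω) (hn : 2 ≤ n) (i : Fin (lg n + 1)) :
    phaseEnd n c κ i (sampled ω i).card ≤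
      (6 * c * (g + 2) + 2 * κ) * (n * lg n ^ 2 + (sampled ω i).card * lg n ^ 3) := by
  have h1 := h.card_sampled_mul_le hn i
  have hlg := one_le_lg hn
  set m := (sampled ω i).card
  have e1 : bfRounds n c i m ≤ 6 * c * (g + 2) * (n * lg n ^ 2) := by
    calc bfRounds n c i m = (m * 2 ^ i.1) * (2 * c * lg n) := by
          rw [bfRounds, depth]; ring
      _ ≤ (3 * (g + 2) * lg n * n) * (2 * c * lg n) := by gcongr
      _ = _ := by ring
  have e2 : numFrames n m * frameLen n κ ≤ 2 * κ * (n * lg n ^ 2 + m * lg n ^ 3) := by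
    calc numFrames n m * frameLen n κ ≤ (m * lg n ^ 2 + (lg n + lg n) * n) * (κ * lg n) := by
          rw [numFrames, fbRounds, frameLen]
          gcongr
      _ = κ * (2 * (n * lg n ^ 2) + m * lg n ^ 3) := by ring
      _ ≤ κ * (2 * (n * lg n ^ 2) + 2 * (m * lg n ^ 3)) := 
        Nat.mul_le_mul_left _ (Nat.add_le_add_left (Nat.le_mul_of_pos_left _ two_pos) _)
      _ = _ := by ring
  calc phaseEnd n c κ i m = bfRounds n c i m + numFrames n m * frameLen n κ := rfl
    _ ≤ 6 * c * (g + 2) * (n * lg n ^ 2 + m * lg n ^ 3) +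
        2 * κ * (n * lg n ^ 2 + m * lg n ^ 3) := by
      gcongr
      exact e1.trans (Nat.mul_le_mul le_rfl (Nat.le_add_right _ _))
    _ = _ := by ring

end Phase

theorem one_le_logb (hn : 2 ≤ n) : 1 ≤ Real.logb 2 n := by
  rw [Real.le_logb_iff_rpow_le one_lt_two (by exact_mod_cast (by omega : 0 < n))]
  simpa using (by exact_mod_cast hn : (2 : ℝ) ≤ n)

theorem lg_le_two_mul_logb (hn : 2 ≤ n) : (lg n : ℝ) ≤ 2 * Real.logb 2 n := by
  have h1 := one_le_logb hn
  have h : ((lg n - 1 : ℕ) : ℝ) ≤ Real.logb 2 n := by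
    rw [Real.le_logb_iff_rpow_le one_lt_two (by exact_mod_cast (by omega : 0 < n)),
      Real.rpow_natCast]
    exact_mod_cast (Nat.pow_pred_clog_lt_self one_lt_two hn).le
  rw [Nat.cast_sub (one_le_lg hn)] at h
  push_cast at h
  linarith

section Phase

variable {N : Network n} {c κ g : ℕ} {tie : Fin n → Fin n → Finset (Fin n) → Fin n}
  {htie : ∀ v s A, A.Nonempty → tie v s A ∈ A} {ω : Coins n}

theorem Typical.phaseEnd_le_logb (h : Typical N c κ g htie ω) (hn : 2 ≤ n)
    (i : Fin (lg n + 1)) : (phaseEnd n c κ i (sampled ω i).card : ℝ) ≤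
      8 * (6 * c * (g + 2) + 2 * κ) * (n * Real.logb 2 n ^ 2 +
        (sampled ω i).card * Real.logb 2 n ^ 3) := by
  have h1 : (phaseEnd n c κ i (sampled ω i).card : ℝ) ≤
      (6 * c * (g + 2) + 2 * κ) * (n * (lg n : ℝ) ^ 2 + (sampled ω i).card * (lg n : ℝ) ^ 3) := by
    exact_mod_cast h.phaseEnd_le hn i
  have hlog := one_le_logb hn
  have hlg := lg_le_two_mul_logb hn
  have h2 : (lg n : ℝ) ^ 2 ≤ 8 * Real.logb 2 n ^ 2 := by
    refine (pow_le_pow_left₀ (Nat.cast_nonneg _) hlg 2).trans ?_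
    rw [mul_pow]
    gcongr
    norm_num
  have h3 : (lg n : ℝ) ^ 3 ≤ 8 * Real.logb 2 n ^ 3 := by
    refine (pow_le_pow_left₀ (Nat.cast_nonneg _) hlg 3).trans ?_
    rw [mul_pow]
    gcongr
    norm_num
  refine h1.trans ?_
  calc (6 * c * (g + 2) + 2 * κ : ℝ) *
        (n * (lg n : ℝ) ^ 2 + (sampled ω i).card * (lg n : ℝ) ^ 3)
      ≤ (6 * c * (g + 2) + 2 * κ) * (n * (8 * Real.logb 2 n ^ 2) +
          (sampled ω i).card * (8 * Real.logb 2 n ^ 3)) := by gcongr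
    _ = _ := by ring

theorem Typical.card_sampled_mul_logb_le (h : Typical N c κ g htie ω) (hn : 2 ≤ n)
    (i : Fin (lg n + 1)) : (sampled ω i).card * Real.logb 2 n ^ 3 ≤
      6 * (g + 2) * (n * Real.logb 2 n ^ 4 / 2 ^ (i : ℕ)) := by
  have h1 : ((sampled ω i).card : ℝ) * 2 ^ i.1 ≤ 3 * (g + 2) * lg n * n := by
    exact_mod_cast h.card_sampled_mul_le hn i
  have hlog := one_le_logb hn
  have hlg := lg_le_two_mul_logb hn
  rw [mul_div_assoc', le_div_iff₀ (by positivity)]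
  calc (sampled ω i).card * Real.logb 2 n ^ 3 * 2 ^ i.1
      = (sampled ω i).card * 2 ^ i.1 * Real.logb 2 n ^ 3 := by ring
    _ ≤ 3 * (g + 2) * (2 * Real.logb 2 n) * n * Real.logb 2 n ^ 3 := by
        refine mul_le_mul_of_nonneg_right (h1.trans ?_) (by positivity)
        gcongr
    _ = _ := by ring

theorem Typical.sum_phaseEnd_le (h : Typical N c κ g htie ω) (hn : 2 ≤ n) :
    ((∑ i : Fin (lg n + 1), phaseEnd n c κ i (sampled ω i).card : ℕ) : ℝ) ≤
      8 * (6 * c * (g + 2) + 2 * κ) * (12 * (g + 2) + 3) * (n * Real.logb 2 n ^ 4) := by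
  have hlog := one_le_logb hn
  have hlg := lg_le_two_mul_logb hn
  have hgeom : ∑ i : Fin (lg n + 1), (1 / 2 : ℝ) ^ i.1 ≤ 2 := by
    rw [Fin.sum_univ_eq_sum_range fun i => (1 / 2 : ℝ) ^ i]
    exact sum_geometric_two_le _
  push_cast
  calc ∑ i : Fin (lg n + 1), (phaseEnd n c κ i (sampled ω i).card : ℝ)
      ≤ ∑ i : Fin (lg n + 1), 8 * (6 * c * (g + 2) + 2 * κ) * (n * Real.logb 2 n ^ 2 +
          6 * (g + 2) * (n * Real.logb 2 n ^ 4 * (1 / 2) ^ i.1)) := by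
        refine Finset.sum_le_sum fun i _ => (h.phaseEnd_le_logb hn i).trans ?_
        refine mul_le_mul_of_nonneg_left (add_le_add le_rfl ?_) (by positivity)
        refine (h.card_sampled_mul_logb_le hn i).trans_eq ?_
        rw [one_div, inv_pow, div_eq_mul_inv]
    _ = 8 * (6 * c * (g + 2) + 2 * κ) * ((lg n + 1) * (n * Real.logb 2 n ^ 2) +
          6 * (g + 2) * (n * Real.logb 2 n ^ 4 * ∑ i : Fin (lg n + 1), (1 / 2) ^ i.1)) := by
        simp only [← Finset.mul_sum, Finset.sum_add_distrib, Finset.sum_const, Finset.card_univ,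
          Fintype.card_fin, nsmul_eq_mul]
        push_cast
        ring
    _ ≤ 8 * (6 * c * (g + 2) + 2 * κ) * ((3 * Real.logb 2 n) * (n * Real.logb 2 n ^ 2) +
          6 * (g + 2) * (n * Real.logb 2 n ^ 4 * 2)) := by
        gcongr
        linarith
    _ = 8 * (6 * c * (g + 2) + 2 * κ) * (3 * (n * Real.logb 2 n ^ 3) +
          12 * (g + 2) * (n * Real.logb 2 n ^ 4)) := by ring
    _ ≤ 8 * (6 * c * (g + 2) + 2 * κ) * (3 * (n * Real.logb 2 n ^ 4) +
          12 * (g + 2) * (n * Real.logb 2 n ^ 4)) := by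
        gcongr
        norm_num
    _ = _ := by ring

end Phase

end CongestAPSP

open CongestAPSP in
theorem mainTheorem5 (c : ℕ) (hc : 1 ≤ c) (γ : ℕ) :
    ∃ (κ : ℕ) (C : ℝ), 0 < C ∧
      ∀ (n : ℕ), 2 ≤ n → ∀ (N : CongestAPSP.Network n)
        (tie : Fin n → Fin n → Finset (Fin n) → Fin n),
        (∀ v s A, A.Nonempty → tie v s A ∈ A) →
        (∀ i : Fin (CongestAPSP.lg n + 1),
          1 - 1 / (n : ℝ) ^ γ ≤ (CongestAPSP.coinMeasure n).real
            {ω | (∃ T : ℕ, CongestAPSP.PhaseTerminates N c κ tie i ω T ∧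
                (T : ℝ) ≤ C * (n * Real.logb 2 n ^ 2 +
                  (CongestAPSP.sampled ω i).card * Real.logb 2 n ^ 3)) ∧
              n * Real.logb 2 n ^ 2 +
                  (CongestAPSP.sampled ω i).card * Real.logb 2 n ^ 3 ≤
                C * (n * Real.logb 2 n ^ 2 + n * Real.logb 2 n ^ 4 / 2 ^ (i : ℕ))}) ∧
        1 - 1 / (n : ℝ) ^ γ ≤ (CongestAPSP.coinMeasure n).real
          {ω | ∃ T : Fin (CongestAPSP.lg n + 1) → ℕ,
            (∀ i, CongestAPSP.PhaseTerminates N c κ tie i ω (T i)) ∧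
            ((∑ i, T i : ℕ) : ℝ) ≤ C * (n * Real.logb 2 n ^ 4)} := by
  refine ⟨4 * (γ + 8) + γ + 8, 8 * (6 * c * ((γ + 3 : ℕ) + 2) + 2 * (4 * (γ + 8) + γ + 8 : ℕ)) *
    (12 * ((γ + 3 : ℕ) + 2) + 3) + 6 * ((γ + 3 : ℕ) + 2), by positivity,
    fun n hn N tie htie => ?_⟩
  obtain ⟨κ, hκ⟩ : ∃ κ, κ = 4 * (γ + 8) + γ + 8 := ⟨_, rfl⟩
  have hbad := prob_not_typical_le N c htie hn γ
  rw [← hκ] at hbad ⊢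
  have hκ1 : 1 ≤ κ := by omega
  generalize γ + 3 = g at hbad ⊢
  obtain ⟨K, hK⟩ : ∃ K : ℝ, K = 8 * (6 * c * (g + 2) + 2 * κ) := ⟨_, rfl⟩
  have hK0 : 0 ≤ K := by rw [hK]; positivity
  rw [← hK]
  have hlog := one_le_logb hn
  have hgood : 1 - 1 / (n : ℝ) ^ γ ≤ prob {ω | Typical N c κ g htie ω} := by
    have := prob_compl {ω | ¬ Typical N c κ g htie ω}
    rw [show {ω | ¬ Typical N c κ g htie ω}ᶜ = {ω | Typical N c κ g htie ω} by ext; simp] at this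
    linarith
  have hg0 : (0 : ℝ) ≤ g := Nat.cast_nonneg g
  refine ⟨fun i => ?_, ?_⟩
  · rw [coinMeasure_real]
    refine hgood.trans (prob_mono fun ω (hω : Typical N c κ g htie ω) => ⟨⟨_,
      hω.phaseTerminates hn hc hκ1 i, (hω.phaseEnd_le_logb hn i).trans ?_⟩, ?_⟩)
    · rw [← hK]
      gcongr
      nlinarith
    · have h1 := hω.card_sampled_mul_logb_le hn i
      have h2 : (0 : ℝ) ≤ n * Real.logb 2 n ^ 2 := by positivity
      have h3 : (0 : ℝ) ≤ n * Real.logb 2 n ^ 4 / 2 ^ (i : ℕ) := by positivity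
      have h4 : 6 * ((g : ℝ) + 2) ≤ K * (12 * (g + 2) + 3) + 6 * (g + 2) := by nlinarith
      calc _ ≤ 6 * ((g : ℝ) + 2) * (n * Real.logb 2 n ^ 2) +
            6 * (g + 2) * (n * Real.logb 2 n ^ 4 / 2 ^ (i : ℕ)) := by
            refine add_le_add ?_ h1
            nlinarith
        _ = 6 * ((g : ℝ) + 2) * (n * Real.logb 2 n ^ 2 +
            n * Real.logb 2 n ^ 4 / 2 ^ (i : ℕ)) := by ring
        _ ≤ _ := by gcongr
  · rw [coinMeasure_real]
    refine hgood.trans (prob_mono fun ω (hω : Typical N c κ g htie ω) => ⟨_,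
      fun i => hω.phaseTerminates hn hc hκ1 i, (hω.sum_phaseEnd_le hn).trans ?_⟩)
    rw [← hK]
    gcongr
    linarith
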